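/- **Setting.** Let $d,N\in\mathbb N$, let $\Omega_0$ be a compact metrizable space, $\Omega=\prod_{x\in\mathbb Z^d}\Omega_0$ with the product topology and the shift action $(\tau_y\omega)_x=\omega_{x-y}$ of $\mathbb Z^d$. Let $\mathbb P$ be a Borel probability measure on $\Omega$ with full topological support that is invariant and ergodic for $\tau$ and invariant under every permutation of the coordinates. Let $\phi$ be a real antisymmetric $d\times d$ matrix. For a compact space $X$ with a $\mathbb Z^d$-action $\tau$ by homeomorphisms, let $C_N(X)$ be the $C^*$-algebra of continuous functions $X\to M_N(\mathbb C)$, and let $\mathcal A(X)$ be the universal $C^*$-algebra generated by $C_N(X)$ and unitaries $u_1,\dots,u_d$ with $$u_iu_j=e^{i\phi_{ij}}u_ju_i,\qquad f\,u_j=u_j\,(f\circ\tau_{e_j})\quad (f\in C_N(X)).$$ With $x\wedge y=\frac12\sum_{i,j}\phi_{ij}x_iy_j$, there are unitaries $u_x$ $(x\in\mathbb Z^d)$, $u_{e_j}=u_j$, $u_xu_y=e^{i x\wedge y}u_{x+y}$, and each $a\in\mathcal A(X)$ has Fourier coefficients $a_x\in C_N(X)$, formally $a=\sum_x a_xu_x$.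 Let $\rho_\lambda$, $\lambda\in\mathbb T^d$, be the automorphisms of $\mathcal A(X)$ that fix $C_N(X)$ and send $u_j\mapsto\lambda_j^{-1}u_j$; $\mathcal A^\infty(X)$ is the set of $a$ for which $\lambda\mapsto\rho_\lambda(a)$ is infinitely differentiable; $\partial_1,\dots,\partial_d$ are the generators of $\rho$, so that $(\partial_ja)_x=-i\,x_ja_x$, and $\partial^\alpha=\partial_1^{\alpha_1}\cdots\partial_d^{\alpha_d}$. For a measure $\mu$ on $X$ put $\mathcal T_\mu(a)=\int_X \mathrm{tr}(a_0(\omega))\,d\mu(\omega)$, with $\mathrm{tr}$ the normalized trace of $M_N(\mathbb C)$. For $L\in\mathbb N$ let $V_L=\{-L,\dots,L\}^d$, let $\tilde\Omega_L\subset\Omega$ be the invariant closed subset of configurations with $\tau_{e_j}^{2L+1}\omega=\omega$ for all $j$, let $\tilde{\mathfrak q}_L:\Omega\to\tilde\Omega_L$ map $\omega$ to the unique element of $\tilde\Omega_L$ that agrees with $\omega$ on $V_L$, and put $\tilde{\mathbb P}_L=(\tilde{\mathfrak q}_L)_*\mathbb P$. Write $\mathcal A_d=\mathcal A(\Omega)$,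 $\tilde{\mathcal A}_d^{(L)}=\mathcal A(\tilde\Omega_L)$, with derivations $\tilde\partial_j$, $\mathcal T=\mathcal T_{\mathbb P}$ and $\widetilde{\mathcal T}=\mathcal T_{\tilde{\mathbb P}_L}$, and let $\tilde{\mathfrak p}_L:\mathcal A_d\to\tilde{\mathcal A}_d^{(L)}$ be the $*$-epimorphism with $\tilde{\mathfrak p}_L(a)_x=a_x|_{\tilde\Omega_L}$. **Theorem.** Let $h\in\mathcal A_d$ be self-adjoint such that * (a1) $h\in\mathcal A_d^\infty=\mathcal A^\infty(\Omega)$; * (a2) for every $K\in\mathbb N$ there is $0<A_K<\infty$ with $\|h_x(\omega)-h_x(\omega')\|\le A_K/(1+|V_M|)^K$ for all $x\in\mathbb Z^d$, all $M\in\mathbb N$ and all $\omega,\omega'\in\Omega$ with $\omega_y=\omega'_y$ for $y\in V_M$. Let $G_1,\dots,G_n:\mathbb R\to\mathbb C$ be smooth over $\sigma(h)$, i.e. each $G_i$ coincides on $\sigma(h)$ with a $C^\infty$ function on $\mathbb R$, and let $\alpha_1,\dots,\alpha_n\in\mathbb N^d$ be multi-indices. Put $\tilde h_L=\tilde{\mathfrak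 p}_L(h)$. Then $G_i(h)\in\mathcal A_d^\infty$ and $G_i(\tilde h_L)\in\mathcal A^\infty(\tilde\Omega_L)$ for all $i$ and $L$, and for every $K\in\mathbb N$ there is a finite constant $A_K$, independent of $L$, such that for all $L\in\mathbb N$ $$\Big|\mathcal T\big(\partial^{\alpha_1}G_1(h)\cdots\partial^{\alpha_n}G_n(h)\big)-\widetilde{\mathcal T}\big(\tilde\partial^{\alpha_1}G_1(\tilde h_L)\cdots\tilde\partial^{\alpha_n}G_n(\tilde h_L)\big)\Big|\le\frac{A_K}{(1+|V_L|)^K}.$$ -/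

import Mathlib

open MeasureTheory

noncomputable section

set_option linter.unusedSectionVars false

namespace NCBT

/-! ### Magnetic flux, phases -/

/-- A magnetic flux matrix: a real antisymmetric `d × d` matrix. -/
structure Flux (d : ℕ) where
  /-- the entries of the flux matrix -/
  entry : Fin d → Fin d → ℝ
  antisymm : ∀ i j, entry i j = -entry j i

variable {d : ℕ}

/-- `x ∧ y = ½ ∑ᵢⱼ φᵢⱼ xᵢ yⱼ`. -/
def wedge (φ : Flux d) (x y : Fin d → ℤ) : ℝ :=
  (1 / 2) * ∑ i, ∑ j, φ.entry i j * x i * y j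

/-- `e^{i x ∧ y}`. -/
def phase (φ : Flux d) (x y : Fin d → ℤ) : ℂ := Complex.exp (wedge φ x y * Complex.I)

theorem wedge_add_left (φ : Flux d) (x x' y : Fin d → ℤ) :
    wedge φ (x + x') y = wedge φ x y + wedge φ x' y := by
  simp only [wedge, ← mul_add, ← Finset.sum_add_distrib, Pi.add_apply, Int.cast_add]
  congr 1
  exact Finset.sum_congr rfl fun i _ => Finset.sum_congr rfl fun j _ => by ring

theorem wedge_antisymm (φ : Flux d) (x y : Fin d → ℤ) : wedge φ x y = -wedge φ y x := by
  simp only [wedge]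
  rw [Finset.sum_comm, ← mul_neg, ← Finset.sum_neg_distrib]
  congr 1
  refine Finset.sum_congr rfl fun i _ => ?_
  rw [← Finset.sum_neg_distrib]
  refine Finset.sum_congr rfl fun j _ => ?_
  rw [φ.antisymm j i]
  ring

theorem wedge_add_right (φ : Flux d) (x y y' : Fin d → ℤ) :
    wedge φ x (y + y') = wedge φ x y + wedge φ x y' := by
  rw [wedge_antisymm, wedge_add_left, wedge_antisymm φ y, wedge_antisymm φ y']
  ring

theorem wedge_self (φ : Flux d) (x : Fin d → ℤ) : wedge φ x x = 0 := by
  have := wedge_antisymm φ x x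
  linarith

theorem phase_add_left (φ : Flux d) (x x' y : Fin d → ℤ) :
    phase φ (x + x') y = phase φ x y * phase φ x' y := by
  simp [phase, wedge_add_left, add_mul, Complex.exp_add]

theorem phase_add_right (φ : Flux d) (x y y' : Fin d → ℤ) :
    phase φ x (y + y') = phase φ x y * phase φ x y' := by
  simp [phase, wedge_add_right, add_mul, Complex.exp_add]

@[simp] theorem phase_self (φ : Flux d) (x : Fin d → ℤ) : phase φ x x = 1 := by
  simp [phase, wedge_self]

@[simp] theorem phase_zero_left (φ : Flux d) (x : Fin d → ℤ) : phase φ 0 x = 1 := by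
  simp [phase, wedge]

@[simp] theorem phase_zero_right (φ : Flux d) (x : Fin d → ℤ) : phase φ x 0 = 1 := by
  simp [phase, wedge]

theorem star_phase (φ : Flux d) (x y : Fin d → ℤ) : star (phase φ x y) = phase φ y x := by
  simp only [phase, Complex.star_def, ← Complex.exp_conj]
  rw [wedge_antisymm φ y x]
  simp

theorem phase_neg_left (φ : Flux d) (x y : Fin d → ℤ) : phase φ (-x) y = phase φ y x := by
  have h : wedge φ (-x) y = wedge φ y x := by
    have h1 := wedge_add_left φ x (-x) y
    have h2 : wedge φ 0 y = 0 := by simp [wedge]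
    rw [add_neg_cancel, h2] at h1
    rw [wedge_antisymm φ y x]
    linarith
  simp [phase, h]

theorem phase_neg_right (φ : Flux d) (x y : Fin d → ℤ) : phase φ x (-y) = phase φ y x := by
  rw [← star_phase, phase_neg_left, star_phase]

@[simp] theorem norm_phase (φ : Flux d) (x y : Fin d → ℤ) : ‖phase φ x y‖ = 1 :=
  Complex.norm_exp_ofReal_mul_I _

/-! ### The algebra `C_N(X)` and the dual action -/

/-- `M_N(ℂ)`, the `N × N` complex matrices. -/
def Mat (N : ℕ) : Type := Matrix (Fin N) (Fin N) ℂ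

open scoped Matrix.Norms.L2Operator in
/-- `M_N(ℂ)` is a `C*`-algebra for the operator norm on the Euclidean space `ℂ^N` and the
conjugate transpose. -/
instance (N : ℕ) : CStarAlgebra (Mat N) :=
  inferInstanceAs (CStarAlgebra (Matrix (Fin N) (Fin N) ℂ))

/-- The normalized trace on `M_N(ℂ)`. -/
def Mat.tr {N : ℕ} (A : Mat N) : ℂ := (N : ℂ)⁻¹ * Matrix.trace (show Matrix (Fin N) (Fin N) ℂ from A)

/-- `C_N(X)`: continuous functions with values in `M_N(ℂ)`, with the sup norm. -/
abbrev MatFun (N : ℕ) (X : Type*) [TopologicalSpace X] : Type _ := C(X, Mat N)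

section Algebra

variable (N : ℕ) (φ : Flux d) (X : Type*) [TopologicalSpace X] [CompactSpace X]
  [AddAction (Fin d → ℤ) X] [ContinuousConstVAdd (Fin d → ℤ) X]

variable {N X} in
/-- The dual action `f ↦ f ∘ τ_y`. -/
def shift (y : Fin d → ℤ) : MatFun N X →⋆ₐ[ℂ] MatFun N X :=
  ContinuousMap.compStarAlgHom' ℂ _ ⟨fun ω => y +ᵥ ω, continuous_const_vadd y⟩

variable {N X} in
@[simp] theorem shift_apply (y : Fin d → ℤ) (f : MatFun N X) (ω : X) :
    shift y f ω = f (y +ᵥ ω) := rfl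

variable {N X} in
theorem shift_shift (y z : Fin d → ℤ) (f : MatFun N X) :
    shift y (shift z f) = shift (y + z) f := by
  ext1 ω
  simp [vadd_vadd, add_comm]

variable {N X} in
@[simp] theorem shift_zero (f : MatFun N X) : shift (0 : Fin d → ℤ) f = f := by
  ext1 ω
  simp

/-! ### The `*`-algebra of covariant polynomials -/

set_option linter.unusedVariables false in
/-- The `*`-algebra of finite sums `∑ₓ aₓ uₓ`, `aₓ ∈ C_N(X)`, where
`uₓ u_y = e^{i x ∧ y} u_{x+y}`, `uₓ* = u_{-x}` and `f uₓ = uₓ (f ∘ τₓ)`. -/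
def CovPoly (φ : Flux d) (X : Type*) [TopologicalSpace X] : Type _ :=
  (Fin d → ℤ) →₀ MatFun N X

namespace CovPoly

instance : AddCommGroup (CovPoly N φ X) :=
  inferInstanceAs (AddCommGroup ((Fin d → ℤ) →₀ MatFun N X))

instance : Module ℂ (CovPoly N φ X) :=
  inferInstanceAs (Module ℂ ((Fin d → ℤ) →₀ MatFun N X))

variable {N φ X}

/-- The monomial `f uₓ`. -/
def mono (x : Fin d → ℤ) : MatFun N X →ₗ[ℂ] CovPoly N φ X := Finsupp.lsingle x

/-- The coefficient `aₓ` of `uₓ`. -/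
def coeff (x : Fin d → ℤ) : CovPoly N φ X →ₗ[ℂ] MatFun N X := Finsupp.lapply x

theorem coeff_mono_same (x : Fin d → ℤ) (f : MatFun N X) :
    coeff x (mono (φ := φ) x f) = f := Finsupp.single_eq_same

theorem coeff_mono_ne {x y : Fin d → ℤ} (h : x ≠ y) (f : MatFun N X) :
    coeff y (mono (φ := φ) x f) = 0 := Finsupp.single_eq_of_ne h.symm

/-- The linear map determined by its values on monomials. -/
def lift {V : Type*} [AddCommGroup V] [Module ℂ V]
    (F : (Fin d → ℤ) → MatFun N X →ₗ[ℂ] V) : CovPoly N φ X →ₗ[ℂ] V :=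
  Finsupp.lsum ℂ F

@[simp] theorem lift_mono {V : Type*} [AddCommGroup V] [Module ℂ V]
    (F : (Fin d → ℤ) → MatFun N X →ₗ[ℂ] V) (x : Fin d → ℤ) (f : MatFun N X) :
    lift F (mono (φ := φ) x f) = F x f := Finsupp.lsum_single ℂ F x f

@[elab_as_elim]
theorem induction {p : CovPoly N φ X → Prop} (a : CovPoly N φ X) (h0 : p 0)
    (hadd : ∀ a b, p a → p b → p (a + b)) (hmono : ∀ x f, p (mono x f)) : p a :=
  Finsupp.induction_linear a h0 hadd hmono

/-- The product on monomials, `(f u_y) (g u_z) = e^{i y ∧ z} f (g ∘ τ_{-y}) u_{y+z}`. -/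
def monoMul (y : Fin d → ℤ) : MatFun N X →ₗ[ℂ] CovPoly N φ X →ₗ[ℂ] CovPoly N φ X :=
  LinearMap.flip <| lift fun z => LinearMap.flip <| LinearMap.mk₂ ℂ
    (fun f g => mono (y + z) (phase φ y z • (f * shift (-y) g)))
    (fun f f' g => by rw [add_mul, smul_add, map_add])
    (fun c f g => by rw [smul_mul_assoc, smul_comm, map_smul])
    (fun f g g' => by rw [map_add, mul_add, smul_add, map_add])
    (fun c f g => by rw [map_smul (shift (-y)) c g, mul_smul_comm, smul_comm, map_smul])

instance : Mul (CovPoly N φ X) := ⟨fun a b => lift monoMul a b⟩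

theorem mono_mul_mono (y z : Fin d → ℤ) (f g : MatFun N X) :
    (mono y f * mono z g : CovPoly N φ X) =
      mono (y + z) (phase φ y z • (f * shift (-y) g)) := by
  change lift monoMul (mono y f) (mono z g) = _
  simp [monoMul]

instance : One (CovPoly N φ X) := ⟨mono 0 1⟩

theorem one_def : (1 : CovPoly N φ X) = mono 0 1 := rfl

protected theorem add_mul (a b c : CovPoly N φ X) : (a + b) * c = a * c + b * c := by
  change lift monoMul (a + b) c = lift monoMul a c + lift monoMul b c
  simp

protected theorem mul_add (a b c : CovPoly N φ X) : a * (b + c) = a * b + a * c :=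
  map_add (lift monoMul a) b c

protected theorem zero_mul (a : CovPoly N φ X) : 0 * a = 0 := by
  change lift monoMul 0 a = 0
  simp

protected theorem mul_zero (a : CovPoly N φ X) : a * 0 = 0 :=
  map_zero (lift monoMul a)

protected theorem smul_mul (c : ℂ) (a b : CovPoly N φ X) : (c • a) * b = c • (a * b) := by
  change lift monoMul (c • a) b = c • lift monoMul a b
  simp

protected theorem mul_smul (c : ℂ) (a b : CovPoly N φ X) : a * (c • b) = c • (a * b) :=
  map_smul (lift monoMul a) c b

protected theorem one_mul (a : CovPoly N φ X) : 1 * a = a := by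
  induction a using induction with
  | h0 => exact CovPoly.mul_zero _
  | hadd a b ha hb => rw [CovPoly.mul_add, ha, hb]
  | hmono x f => simp [one_def, mono_mul_mono]

protected theorem mul_one (a : CovPoly N φ X) : a * 1 = a := by
  induction a using induction with
  | h0 => exact CovPoly.zero_mul _
  | hadd a b ha hb => rw [CovPoly.add_mul, ha, hb]
  | hmono x f => simp [one_def, mono_mul_mono]

protected theorem mul_assoc (a b c : CovPoly N φ X) : a * b * c = a * (b * c) := by
  induction a using induction with
  | h0 => simp only [CovPoly.zero_mul]
  | hadd a b ha hb => simp only [CovPoly.add_mul, ha, hb]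
  | hmono x f =>
    induction b using induction with
    | h0 => simp only [CovPoly.zero_mul, CovPoly.mul_zero]
    | hadd a b ha hb => simp only [CovPoly.add_mul, CovPoly.mul_add, ha, hb]
    | hmono y g =>
      induction c using induction with
      | h0 => simp only [CovPoly.mul_zero]
      | hadd a b ha hb => simp only [CovPoly.mul_add, ha, hb]
      | hmono z k =>
        rw [mono_mul_mono, mono_mul_mono, mono_mul_mono, mono_mul_mono, add_assoc]
        congr 1
        rw [map_smul, map_mul, shift_shift, ← neg_add, smul_mul_assoc, mul_smul_comm, smul_smul,
          smul_smul, phase_add_left, phase_add_right, mul_assoc f]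
        congr 1
        ring

instance : Ring (CovPoly N φ X) where
  left_distrib := CovPoly.mul_add
  right_distrib := CovPoly.add_mul
  zero_mul := CovPoly.zero_mul
  mul_zero := CovPoly.mul_zero
  mul_assoc := CovPoly.mul_assoc
  one_mul := CovPoly.one_mul
  mul_one := CovPoly.mul_one
  neg_add_cancel := neg_add_cancel
  zsmul := fun n a => n • a
  zsmul_zero' := fun a => zero_smul ℤ a
  zsmul_succ' := fun n a => SubNegMonoid.zsmul_succ' n a
  zsmul_neg' := fun n a => SubNegMonoid.zsmul_neg' n a
  sub_eq_add_neg := sub_eq_add_neg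
  nsmul := fun n a => n • a
  nsmul_zero := fun a => zero_smul ℕ a
  nsmul_succ := fun n a => succ_nsmul a n

instance : Algebra ℂ (CovPoly N φ X) :=
  Algebra.ofModule CovPoly.smul_mul CovPoly.mul_smul

/-- The involution, `(f uₓ)* = (f* ∘ τₓ) u_{-x}`. -/
def starAdd : CovPoly N φ X →+ CovPoly N φ X :=
  Finsupp.liftAddHom fun x =>
    ((mono (φ := φ) (-x)).toAddMonoidHom.comp
      ((shift (N := N) (X := X) x : MatFun N X →+* MatFun N X) : MatFun N X →+ MatFun N X)).comp
      (starAddEquiv (R := MatFun N X)).toAddMonoidHom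

instance : Star (CovPoly N φ X) := ⟨starAdd⟩

theorem star_mono (x : Fin d → ℤ) (f : MatFun N X) :
    star (mono x f : CovPoly N φ X) = mono (-x) (shift x (star f)) :=
  Finsupp.liftAddHom_apply_single _ _ _

protected theorem star_add (a b : CovPoly N φ X) : star (a + b) = star a + star b :=
  map_add starAdd a b

protected theorem star_zero : star (0 : CovPoly N φ X) = 0 := map_zero starAdd

protected theorem star_star (a : CovPoly N φ X) : star (star a) = a := by
  induction a using induction with
  | h0 => simp only [CovPoly.star_zero]
  | hadd a b ha hb => rw [CovPoly.star_add, CovPoly.star_add, ha, hb]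
  | hmono x f =>
    rw [star_mono, star_mono, ← map_star, star_star, shift_shift]
    simp

protected theorem star_mul (a b : CovPoly N φ X) : star (a * b) = star b * star a := by
  induction a using induction with
  | h0 => simp only [zero_mul, mul_zero, CovPoly.star_zero]
  | hadd a b ha hb => simp only [add_mul, mul_add, CovPoly.star_add, ha, hb]
  | hmono x f =>
    induction b using induction with
    | h0 => simp only [zero_mul, mul_zero, CovPoly.star_zero]
    | hadd a b ha hb => simp only [add_mul, mul_add, CovPoly.star_add, ha, hb]
    | hmono y g =>
      rw [star_mono, star_mono, mono_mul_mono, mono_mul_mono, star_mono, neg_add_rev]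
      congr 1
      rw [star_smul, star_mul, map_smul, map_mul, star_phase, ← map_star, shift_shift, shift_shift,
        phase_neg_right, phase_neg_right]
      simp [add_comm]

instance : StarRing (CovPoly N φ X) where
  star_involutive := CovPoly.star_star
  star_mul := CovPoly.star_mul
  star_add := CovPoly.star_add

instance : StarModule ℂ (CovPoly N φ X) where
  star_smul c a := by
    induction a using induction with
    | h0 => simp
    | hadd a b ha hb => simp only [smul_add, star_add, ha, hb]
    | hmono x f => rw [← map_smul, star_mono, star_mono, star_smul, map_smul, map_smul]

/-- A linear map between polynomial algebras that is multiplicative, unital and `*`-preserving on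
monomials is a `*`-homomorphism. -/
def homMk {D : Type*} [Ring D] [StarRing D] [Algebra ℂ D] [StarModule ℂ D]
    (F : CovPoly N φ X →ₗ[ℂ] D)
    (h1 : F 1 = 1)
    (hmul : ∀ x f y g, F (mono x f * mono y g) = F (mono x f) * F (mono y g))
    (hstar : ∀ x f, F (star (mono x f)) = star (F (mono x f))) :
    CovPoly N φ X →⋆ₐ[ℂ] D :=
  { AlgHom.ofLinearMap F h1 (fun a b => by
      induction a using induction with
      | h0 => simp
      | hadd a b ha hb => simp only [add_mul, map_add, ha, hb]
      | hmono x f =>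
        induction b using induction with
        | h0 => simp
        | hadd a b ha hb => simp only [mul_add, map_add, ha, hb]
        | hmono y g => exact hmul x f y g) with
    map_star' := fun a => by
      change F (star a) = star (F a)
      induction a using induction with
      | h0 => simp
      | hadd a b ha hb => simp only [star_add, map_add, ha, hb]
      | hmono x f => exact hstar x f }

@[simp] theorem homMk_apply {D : Type*} [Ring D] [StarRing D] [Algebra ℂ D] [StarModule ℂ D]
    (F : CovPoly N φ X →ₗ[ℂ] D) (h1 hmul hstar) (a : CovPoly N φ X) :
    homMk F h1 hmul hstar a = F a := rfl

end CovPoly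

/-! ### The enveloping `C*`-algebra -/

/-- A `C*`-seminorm on a complex `*`-algebra. -/
structure CStarSeminorm (R : Type*) [Ring R] [StarRing R] [Algebra ℂ R] extends
    Seminorm ℂ R where
  mul_le' : ∀ a b, toFun (a * b) ≤ toFun a * toFun b
  star_mul_self' : ∀ a, toFun (star a * a) = toFun a ^ 2

namespace CStarSeminorm

variable {R : Type*} [Ring R] [StarRing R] [Algebra ℂ R]

instance : CoeFun (CStarSeminorm R) fun _ => R → ℝ := ⟨fun p => p.toSeminorm⟩

theorem mul_le (p : CStarSeminorm R) (a b : R) : p (a * b) ≤ p a * p b := p.mul_le' a b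

theorem star_mul_self (p : CStarSeminorm R) (a : R) : p (star a * a) = p a ^ 2 :=
  p.star_mul_self' a

theorem nonneg (p : CStarSeminorm R) (a : R) : 0 ≤ p a := apply_nonneg p.toSeminorm a

theorem le_star (p : CStarSeminorm R) (a : R) : p a ≤ p (star a) := by
  by_contra! h
  have h1 := p.mul_le (star a) a
  rw [star_mul_self] at h1
  have h0 := p.nonneg (star a)
  nlinarith

theorem apply_star (p : CStarSeminorm R) (a : R) : p (star a) = p a :=
  le_antisymm (by simpa using p.le_star (star a)) (p.le_star a)

theorem unitary_le_one (p : CStarSeminorm R) (u : R) (hu : star u * u = 1) : p u ≤ 1 := by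
  have h1 : p (1 : R) = p (1 : R) ^ 2 := by simpa using p.star_mul_self (1 : R)
  have h2 := p.star_mul_self u
  rw [hu] at h2
  by_contra! h
  have h3 : p (1 : R) ≤ 1 := by
    by_contra! h4
    nlinarith
  nlinarith

/-- The zero seminorm. -/
instance : Inhabited (CStarSeminorm R) :=
  ⟨{ (0 : Seminorm ℂ R) with
      mul_le' := fun a b => by
        change (0 : ℝ) ≤ 0 * 0
        simp
      star_mul_self' := fun a => by
        change (0 : ℝ) = 0 ^ 2
        simp }⟩

/-- The pull-back of a `C*`-seminorm along a `*`-homomorphism. -/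
def comap {S : Type*} [Ring S] [StarRing S] [Algebra ℂ S] (p : CStarSeminorm S)
    (F : R →⋆ₐ[ℂ] S) : CStarSeminorm R where
  toSeminorm := p.toSeminorm.comp F.toAlgHom.toLinearMap
  mul_le' a b := by
    change p (F (a * b)) ≤ p (F a) * p (F b)
    rw [map_mul]
    exact p.mul_le _ _
  star_mul_self' a := by
    change p (F (star a * a)) = p (F a) ^ 2
    rw [map_mul, map_star]
    exact p.star_mul_self _

theorem comap_apply {S : Type*} [Ring S] [StarRing S] [Algebra ℂ S] (p : CStarSeminorm S)
    (F : R →⋆ₐ[ℂ] S) (a : R) : p.comap F a = p (F a) := rfl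

/-- The norm of a `C*`-algebra. -/
def ofNorm (D : Type*) [CStarAlgebra D] : CStarSeminorm D where
  toSeminorm := normSeminorm ℂ D
  mul_le' := norm_mul_le
  star_mul_self' a := by
    change ‖star a * a‖ = ‖a‖ ^ 2
    rw [CStarRing.norm_star_mul_self, sq]

/-- On a `C*`-algebra every `C*`-seminorm is bounded by the norm. -/
theorem le_norm {D : Type*} [CStarAlgebra D] (p : CStarSeminorm D) (a : D) : p a ≤ ‖a‖ := by
  let : PartialOrder D := CStarAlgebra.spectralOrder D
  let : StarOrderedRing D := CStarAlgebra.spectralOrderedRing D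
  have key : ∀ b : selfAdjoint D, ‖b‖ ≤ 1 → p (b : D) ≤ 1 := by
    intro b hb
    set u := selfAdjoint.unitarySelfAddISMul b hb with hu
    have h1 : (b : D) = (1 / 2 : ℂ) • ((u : D) + star (u : D)) := by
      have := congrArg Subtype.val (selfAdjoint.realPart_unitarySelfAddISMul b hb)
      rw [← hu, realPart_apply_coe] at this
      rw [← this, ← Complex.coe_smul]
      norm_num
    have h2 : p (u : D) ≤ 1 := p.unitary_le_one _ (Unitary.star_mul_self_of_mem u.2)
    have h3 : p (star (u : D)) ≤ 1 := by rwa [apply_star]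
    rw [h1, map_smul_eq_mul]
    have h4 : p ((u : D) + star (u : D)) ≤ p (u : D) + p (star (u : D)) :=
      map_add_le_add p.toSeminorm _ _
    norm_num
    linarith
  have h2 : p (star a * a) ≤ ‖a‖ ^ 2 := by
    rcases eq_or_ne a 0 with rfl | ha
    · simp
    have hpos : 0 < ‖a‖ ^ 2 := by positivity
    have hs : IsSelfAdjoint (((‖a‖ ^ 2)⁻¹ : ℝ) • (star a * a)) :=
      IsSelfAdjoint.smul (IsSelfAdjoint.all _) (IsSelfAdjoint.star_mul_self a)
    have := key ⟨_, hs⟩ (by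
      change ‖((‖a‖ ^ 2)⁻¹ : ℝ) • (star a * a)‖ ≤ 1
      rw [norm_smul, CStarRing.norm_star_mul_self, Real.norm_of_nonneg (by positivity), sq]
      exact inv_mul_le_one)
    change p (((‖a‖ ^ 2)⁻¹ : ℝ) • (star a * a)) ≤ 1 at this
    rw [← Complex.coe_smul, map_smul_eq_mul, Complex.norm_real,
      Real.norm_of_nonneg (by positivity), inv_mul_le_iff₀ hpos, mul_one] at this
    exact this
  rw [star_mul_self] at h2
  exact le_of_sq_le_sq h2 (norm_nonneg _)

end CStarSeminorm

namespace CovPoly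

variable {N φ X}

/-- The embedding of `C_N(X)` as the coefficients of `u₀`. -/
def incl : MatFun N X →⋆ₐ[ℂ] CovPoly N φ X :=
  { AlgHom.ofLinearMap (mono (φ := φ) 0) rfl (fun f g => by
      rw [mono_mul_mono]
      simp) with
    map_star' := fun f => by
      change mono 0 (star f) = star (mono 0 f)
      rw [star_mono]
      simp }

theorem incl_apply (f : MatFun N X) : (incl f : CovPoly N φ X) = mono 0 f := rfl

/-- The unitary `uₓ`. -/
def u (x : Fin d → ℤ) : CovPoly N φ X := mono x 1

theorem star_u_mul_u (x : Fin d → ℤ) : star (u x) * u x = (1 : CovPoly N φ X) := by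
  rw [u, star_mono, mono_mul_mono, one_def]
  simp [phase_neg_left]

theorem incl_mul_u (x : Fin d → ℤ) (f : MatFun N X) :
    (incl f * u x : CovPoly N φ X) = mono x f := by
  rw [incl_apply, u, mono_mul_mono]
  simp

/-- `uₓ u_y = e^{i x ∧ y} u_{x+y}`. -/
theorem u_mul_u (x y : Fin d → ℤ) :
    (u x * u y : CovPoly N φ X) = phase φ x y • u (x + y) := by
  rw [u, u, u, mono_mul_mono, ← map_smul]
  simp

/-- `f uₓ = uₓ (f ∘ τₓ)`. -/
theorem incl_mul_u_eq (x : Fin d → ℤ) (f : MatFun N X) :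
    (incl f * u x : CovPoly N φ X) = u x * incl (shift x f) := by
  rw [incl_mul_u, incl_apply, u, mono_mul_mono, shift_shift]
  simp

theorem bddAbove (a : CovPoly N φ X) :
    BddAbove (Set.range fun p : CStarSeminorm (CovPoly N φ X) => p a) := by
  induction a using induction with
  | h0 => exact ⟨0, by rintro _ ⟨p, rfl⟩; exact (map_zero p.toSeminorm).le⟩
  | hadd a b ha hb =>
    obtain ⟨A, hA⟩ := ha
    obtain ⟨B, hB⟩ := hb
    refine ⟨A + B, ?_⟩
    rintro _ ⟨p, rfl⟩
    exact (map_add_le_add p.toSeminorm _ _).trans (add_le_add (hA ⟨p, rfl⟩) (hB ⟨p, rfl⟩))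
  | hmono x f =>
    refine ⟨‖f‖, ?_⟩
    rintro _ ⟨p, rfl⟩
    change p (mono x f) ≤ ‖f‖
    rw [← incl_mul_u]
    have h1 : p (incl f) ≤ ‖f‖ := (p.comap incl).le_norm f
    have h2 : p (u x) ≤ 1 := p.unitary_le_one _ (star_u_mul_u x)
    calc p (incl f * u x) ≤ p (incl f) * p (u x) := p.mul_le _ _
      _ ≤ ‖f‖ * 1 := mul_le_mul h1 h2 (p.nonneg _) (norm_nonneg _)
      _ = ‖f‖ := mul_one _

/-- The universal norm: the supremum of all `C*`-seminorms. -/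
instance : Norm (CovPoly N φ X) := ⟨fun a => ⨆ p : CStarSeminorm (CovPoly N φ X), p a⟩

theorem norm_def (a : CovPoly N φ X) :
    ‖a‖ = ⨆ p : CStarSeminorm (CovPoly N φ X), p a := rfl

theorem le_univ (p : CStarSeminorm (CovPoly N φ X)) (a : CovPoly N φ X) : p a ≤ ‖a‖ :=
  le_ciSup (bddAbove a) p

theorem univ_le {a : CovPoly N φ X} {C : ℝ}
    (h : ∀ p : CStarSeminorm (CovPoly N φ X), p a ≤ C) : ‖a‖ ≤ C := ciSup_le h

protected theorem norm_nonneg (a : CovPoly N φ X) : 0 ≤ ‖a‖ :=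
  (CStarSeminorm.nonneg default a).trans (le_univ default a)

instance : SeminormedRing (CovPoly N φ X) :=
  { (inferInstance : Ring (CovPoly N φ X)),
    AddGroupSeminorm.toSeminormedAddCommGroup (E := CovPoly N φ X)
      { toFun := fun a => ‖a‖
        map_zero' := le_antisymm (univ_le fun p => (map_zero p.toSeminorm).le)
          (CovPoly.norm_nonneg _)
        add_le' := fun a b => univ_le fun p => (map_add_le_add p.toSeminorm a b).trans
          (add_le_add (le_univ p a) (le_univ p b))
        neg' := fun a => by
          rw [norm_def, norm_def]
          exact congrArg _ (funext fun p => map_neg_eq_map p.toSeminorm a) } with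
    norm_mul_le := fun a b => univ_le fun p => (p.mul_le a b).trans
      (mul_le_mul (le_univ p a) (le_univ p b) (p.nonneg b) (CovPoly.norm_nonneg a)) }

instance : NormedAlgebra ℂ (CovPoly N φ X) where
  norm_smul_le c a := univ_le fun p => by
    rw [map_smul_eq_mul]
    exact mul_le_mul_of_nonneg_left (le_univ p a) (norm_nonneg c)

theorem norm_star' (a : CovPoly N φ X) : ‖star a‖ = ‖a‖ := by
  rw [norm_def, norm_def]
  exact congrArg _ (funext fun p => p.apply_star a)

theorem norm_sq_le (a : CovPoly N φ X) : ‖a‖ * ‖a‖ ≤ ‖star a * a‖ := by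
  have h : ‖a‖ ≤ Real.sqrt ‖star a * a‖ := univ_le fun p =>
    Real.le_sqrt_of_sq_le (by
      rw [← p.star_mul_self]
      exact le_univ p _)
  calc ‖a‖ * ‖a‖ ≤ Real.sqrt ‖star a * a‖ * Real.sqrt ‖star a * a‖ :=
        mul_self_le_mul_self (norm_nonneg a) h
    _ = ‖star a * a‖ := Real.mul_self_sqrt (norm_nonneg _)

/-- `*`-homomorphisms between polynomial algebras are contractive for the universal norms. -/
theorem norm_map_le {d' N' : ℕ} {φ' : Flux d'} {Y : Type*} [TopologicalSpace Y] [CompactSpace Y]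
    [AddAction (Fin d' → ℤ) Y] [ContinuousConstVAdd (Fin d' → ℤ) Y]
    (F : CovPoly N φ X →⋆ₐ[ℂ] CovPoly N' φ' Y) (a : CovPoly N φ X) : ‖F a‖ ≤ ‖a‖ :=
  univ_le fun p => le_univ (p.comap F) a

end CovPoly

/-- The algebra of observables: the universal `C*`-algebra generated by `C_N(X)` and unitaries
`u₁, …, u_d` with `uᵢ uⱼ = e^{i φᵢⱼ} uⱼ uᵢ` and `f uⱼ = uⱼ (f ∘ τ_{eⱼ})`, that is, the completion
of the `*`-algebra of covariant polynomials in its largest `C*`-seminorm. -/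
def ObsAlg : Type _ := UniformSpace.Completion (CovPoly N φ X)

namespace ObsAlg

open UniformSpace

instance : NormedRing (ObsAlg N φ X) :=
  inferInstanceAs (NormedRing (Completion (CovPoly N φ X)))

instance : CompleteSpace (ObsAlg N φ X) :=
  inferInstanceAs (CompleteSpace (Completion (CovPoly N φ X)))

instance : NormedAlgebra ℂ (ObsAlg N φ X) :=
  { (inferInstance : Algebra ℂ (Completion (CovPoly N φ X))) with
    norm_smul_le := (inferInstance : NormedSpace ℂ (Completion (CovPoly N φ X))).norm_smul_le }

variable {N φ X}

/-- The canonical map from polynomials. -/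
def of : CovPoly N φ X → ObsAlg N φ X := fun a => (a : Completion (CovPoly N φ X))

theorem of_add (a b : CovPoly N φ X) : of (a + b) = of a + of b := Completion.coe_add a b
theorem of_mul (a b : CovPoly N φ X) : of (a * b) = of a * of b := Completion.coe_mul a b
theorem of_smul (c : ℂ) (a : CovPoly N φ X) : of (c • a) = c • of a := Completion.coe_smul c a
theorem of_one : of (1 : CovPoly N φ X) = 1 := rfl
theorem of_zero : of (0 : CovPoly N φ X) = 0 := rfl
theorem norm_of (a : CovPoly N φ X) : ‖of a‖ = ‖a‖ := Completion.norm_coe a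
theorem denseRange_of : DenseRange (of : CovPoly N φ X → ObsAlg N φ X) :=
  Completion.denseRange_coe
theorem continuous_of : Continuous (of : CovPoly N φ X → ObsAlg N φ X) :=
  Completion.continuous_coe _

theorem induction {p : ObsAlg N φ X → Prop} (a : ObsAlg N φ X) (hp : IsClosed {a | p a})
    (h : ∀ b : CovPoly N φ X, p (of b)) : p a := Completion.induction_on a hp h

theorem uniformContinuous_star :
    UniformContinuous (star : CovPoly N φ X → CovPoly N φ X) := by
  refine (LipschitzWith.of_dist_le_mul (K := 1) fun a b => ?_).uniformContinuous
  rw [dist_eq_norm, dist_eq_norm, ← star_sub, CovPoly.norm_star']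
  simp

instance : Star (ObsAlg N φ X) := ⟨Completion.map star⟩

theorem of_star (a : CovPoly N φ X) : of (star a) = star (of a) :=
  (Completion.map_coe uniformContinuous_star a).symm

theorem continuous_star : Continuous (star : ObsAlg N φ X → ObsAlg N φ X) :=
  Completion.continuous_map

instance : StarRing (ObsAlg N φ X) where
  star_involutive a := by
    induction a using induction with
    | hp => exact isClosed_eq (continuous_star.comp continuous_star) continuous_id
    | h a => rw [← of_star, ← of_star, star_star]
  star_mul a b := by
    induction a using induction with
    | hp => exact isClosed_eq (continuous_star.comp (continuous_mul_const b))
              ((continuous_const_mul (star b)).comp continuous_star)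
    | h a =>
      induction b using induction with
      | hp => exact isClosed_eq (continuous_star.comp (continuous_const_mul (of a)))
                ((continuous_mul_const (star (of a))).comp continuous_star)
      | h b => rw [← of_mul, ← of_star, ← of_star, ← of_star, ← of_mul, star_mul]
  star_add a b := by
    induction a using induction with
    | hp => exact isClosed_eq (continuous_star.comp (continuous_add_const b))
              ((continuous_add_const (star b)).comp continuous_star)
    | h a =>
      induction b using induction with
      | hp => exact isClosed_eq (continuous_star.comp (continuous_const_add (of a)))
                ((continuous_const_add (star (of a))).comp continuous_star)
      | h b => rw [← of_add, ← of_star, ← of_star, ← of_star, ← of_add, star_add]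

instance : CStarRing (ObsAlg N φ X) where
  norm_mul_self_le a := by
    induction a using induction with
    | hp => exact isClosed_le (continuous_norm.mul continuous_norm)
              (continuous_norm.comp (continuous_star.mul continuous_id))
    | h a =>
      rw [← of_star, ← of_mul, norm_of, norm_of]
      exact CovPoly.norm_sq_le a

instance : StarModule ℂ (ObsAlg N φ X) where
  star_smul c a := by
    induction a using induction with
    | hp => exact isClosed_eq (continuous_star.comp (continuous_const_smul c))
              ((continuous_const_smul (star c)).comp continuous_star)
    | h a => rw [← of_smul, ← of_star, ← of_star, ← of_smul, star_smul]

instance : CStarAlgebra (ObsAlg N φ X) where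

/-- The continuous extension of a `*`-homomorphism between polynomial algebras, as a function. -/
def mapFun {d' N' : ℕ} {φ' : Flux d'} {Y : Type*} [TopologicalSpace Y] [CompactSpace Y]
    [AddAction (Fin d' → ℤ) Y] [ContinuousConstVAdd (Fin d' → ℤ) Y]
    (F : CovPoly N φ X →⋆ₐ[ℂ] CovPoly N' φ' Y) : ObsAlg N φ X → ObsAlg N' φ' Y :=
  Completion.map F

section map

variable {d' N' : ℕ} {φ' : Flux d'} {Y : Type*} [TopologicalSpace Y] [CompactSpace Y]
    [AddAction (Fin d' → ℤ) Y] [ContinuousConstVAdd (Fin d' → ℤ) Y]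
    (F : CovPoly N φ X →⋆ₐ[ℂ] CovPoly N' φ' Y)

theorem mapFun_of (a : CovPoly N φ X) : mapFun F (of a) = of (F a) := by
  refine Completion.map_coe ?_ a
  refine (LipschitzWith.of_dist_le_mul (K := 1) fun a b => ?_).uniformContinuous
  rw [dist_eq_norm, dist_eq_norm, ← map_sub]
  simpa using CovPoly.norm_map_le F (a - b)

theorem continuous_mapFun : Continuous (mapFun F) := Completion.continuous_map

/-- The continuous extension of a `*`-homomorphism between polynomial algebras. -/
def map : ObsAlg N φ X →⋆ₐ[ℂ] ObsAlg N' φ' Y where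
  toFun := mapFun F
  map_one' := by rw [← of_one, mapFun_of, map_one, of_one]
  map_zero' := by rw [← of_zero, mapFun_of, map_zero, of_zero]
  map_add' a b := by
    induction a using induction with
    | hp => exact isClosed_eq ((continuous_mapFun F).comp (continuous_add_const b))
              ((continuous_add_const _).comp (continuous_mapFun F))
    | h a =>
      induction b using induction with
      | hp => exact isClosed_eq ((continuous_mapFun F).comp (continuous_const_add (of a)))
                ((continuous_const_add _).comp (continuous_mapFun F))
      | h b => rw [← of_add, mapFun_of, mapFun_of, mapFun_of, ← of_add, map_add]
  map_mul' a b := by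
    induction a using induction with
    | hp => exact isClosed_eq ((continuous_mapFun F).comp (continuous_mul_const b))
              ((continuous_mul_const _).comp (continuous_mapFun F))
    | h a =>
      induction b using induction with
      | hp => exact isClosed_eq ((continuous_mapFun F).comp (continuous_const_mul (of a)))
                ((continuous_const_mul _).comp (continuous_mapFun F))
      | h b => rw [← of_mul, mapFun_of, mapFun_of, mapFun_of, ← of_mul, map_mul]
  commutes' c := by
    change mapFun F (algebraMap ℂ _ c) = algebraMap ℂ _ c
    rw [Algebra.algebraMap_eq_smul_one, Algebra.algebraMap_eq_smul_one, ← of_one, ← of_smul,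
      mapFun_of, map_smul, map_one, of_smul, of_one]
  map_star' a := by
    induction a using induction with
    | hp => exact isClosed_eq ((continuous_mapFun F).comp continuous_star)
              (continuous_star.comp (continuous_mapFun F))
    | h a => rw [← of_star, mapFun_of, mapFun_of, ← of_star, map_star]

end map

end ObsAlg

/-! ### The canonical representations on `ℂ^N ⊗ ℓ²(ℤ^d)` -/

/-- `M_N(ℂ)` acting on `ℂ^N`. -/
def Mat.act {N : ℕ} : Mat N →⋆ₐ[ℂ] (EuclideanSpace ℂ (Fin N) →L[ℂ] EuclideanSpace ℂ (Fin N)) :=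
  StarAlgHomClass.toStarAlgHom (Matrix.toEuclideanCLM (n := Fin N) (𝕜 := ℂ))

theorem Mat.norm_act {N : ℕ} (A : Mat N) : ‖Mat.act A‖ = ‖A‖ := rfl

/-- The Hilbert space `ℂ^N ⊗ ℓ²(ℤ^d) = ℓ²(ℤ^d; ℂ^N)`. -/
abbrev Hil (N d : ℕ) : Type := lp (fun _ : Fin d → ℤ => EuclideanSpace ℂ (Fin N)) 2

namespace CovPoly

variable {N φ X}

theorem memlp_op (ω : X) (y : Fin d → ℤ) (f : MatFun N X) (ψ : Hil N d) :
    Memℓp (fun x : Fin d → ℤ => phase φ y x • Mat.act (f (x +ᵥ ω)) (ψ (x - y))) 2 ∧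
      ∑' x, ‖phase φ y x • Mat.act (f (x +ᵥ ω)) (ψ (x - y))‖ ^ 2 ≤ (‖f‖ * ‖ψ‖) ^ 2 := by
  have hs : Summable fun x => ‖ψ x‖ ^ 2 := by
    simpa using (lp.memℓp ψ).summable (by norm_num)
  have hs' : Summable fun x => ‖f‖ ^ 2 * ‖ψ (x - y)‖ ^ 2 :=
    (hs.comp_injective (sub_left_injective (b := y))).mul_left _
  have hb : ∀ x, ‖phase φ y x • Mat.act (f (x +ᵥ ω)) (ψ (x - y))‖ ^ 2 ≤
      ‖f‖ ^ 2 * ‖ψ (x - y)‖ ^ 2 := by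
    intro x
    rw [norm_smul, norm_phase, one_mul, ← mul_pow]
    refine pow_le_pow_left₀ (norm_nonneg _) ?_ 2
    refine (ContinuousLinearMap.le_opNorm _ _).trans ?_
    rw [Mat.norm_act]
    exact mul_le_mul_of_nonneg_right (f.norm_coe_le_norm _) (norm_nonneg _)
  have hs'' := Summable.of_nonneg_of_le (fun x => by positivity) hb hs'
  refine ⟨memℓp_gen (by simpa using hs''), ?_⟩
  refine (hs''.tsum_le_tsum hb hs').trans ?_
  rw [tsum_mul_left, mul_pow]
  refine mul_le_mul_of_nonneg_left ?_ (by positivity)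
  have h1 := (Equiv.subRight y).tsum_eq fun x => ‖ψ x‖ ^ 2
  have h2 := lp.norm_rpow_eq_tsum (p := 2) (by norm_num) ψ
  simp only [ENNReal.toReal_ofNat, Real.rpow_ofNat] at h2
  rw [h2]
  exact h1.le

/-- `π_ω(f u_y)`, which maps `ψ` to `x ↦ e^{i y ∧ x} f(τ_x ω) ψ(x - y)`. -/
def op (φ : Flux d) (ω : X) (y : Fin d → ℤ) (f : MatFun N X) : Hil N d →L[ℂ] Hil N d :=
  LinearMap.mkContinuous
    { toFun := fun ψ => ⟨_, (memlp_op (φ := φ) ω y f ψ).1⟩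
      map_add' := fun ψ χ => by
        ext1
        funext x
        simp [smul_add]
        rfl
      map_smul' := fun c ψ => by
        ext1
        funext x
        simp [smul_comm c] } ‖f‖ (fun ψ => by
      refine le_of_sq_le_sq ?_ (by positivity)
      have h2 := lp.norm_rpow_eq_tsum (p := 2) (by norm_num)
        (⟨_, (memlp_op (φ := φ) ω y f ψ).1⟩ : Hil N d)
      simp only [ENNReal.toReal_ofNat, Real.rpow_ofNat] at h2
      exact h2.le.trans (memlp_op (φ := φ) ω y f ψ).2)

theorem op_apply (ω : X) (y : Fin d → ℤ) (f : MatFun N X) (ψ : Hil N d) (x : Fin d → ℤ) :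
    op φ ω y f ψ x = phase φ y x • Mat.act (f (x +ᵥ ω)) (ψ (x - y)) := rfl

/-- The canonical representation `π_ω` as a linear map. -/
def repLin (ω : X) : CovPoly N φ X →ₗ[ℂ] (Hil N d →L[ℂ] Hil N d) :=
  lift fun y =>
    { toFun := op φ ω y
      map_add' := fun f g => by
        ext ψ : 1
        ext1
        funext x
        simp [op_apply]
      map_smul' := fun c f => by
        ext ψ : 1
        ext1
        funext x
        simp [op_apply, smul_comm c] }

theorem repLin_mono (ω : X) (y : Fin d → ℤ) (f : MatFun N X) :
    repLin ω (mono y f : CovPoly N φ X) = op φ ω y f := lift_mono _ _ _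

/-- The canonical representation `π_ω`. -/
def rep (ω : X) : CovPoly N φ X →⋆ₐ[ℂ] (Hil N d →L[ℂ] Hil N d) :=
  homMk (repLin ω)
    (by
      rw [one_def, repLin_mono]
      ext ψ : 1
      ext1
      funext x
      simp [op_apply])
    (fun y f z g => by
      rw [mono_mul_mono, repLin_mono, repLin_mono, repLin_mono]
      ext ψ : 1
      ext1
      funext x
      have h1 : phase φ (y + z) x * phase φ y z = phase φ y x * phase φ z (x - y) := by
        rw [phase_add_left, sub_eq_add_neg, phase_add_right, phase_neg_right]
        ring
      have h2 : -y +ᵥ (x +ᵥ ω) = (x - y) +ᵥ ω := by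
        rw [vadd_vadd, neg_add_eq_sub]
      simp [op_apply, smul_smul, h1, h2, sub_sub])
    (fun y f => by
      rw [star_mono, repLin_mono, repLin_mono, ContinuousLinearMap.star_eq_adjoint,
        ContinuousLinearMap.eq_adjoint_iff]
      intro ψ χ
      rw [lp.inner_eq_tsum, lp.inner_eq_tsum, ← (Equiv.subRight y).tsum_eq]
      refine tsum_congr fun x => ?_
      have h2 : y +ᵥ ((x - y) +ᵥ ω) = x +ᵥ ω := by
        rw [vadd_vadd, add_sub_cancel]
      have h3 : phase φ (-y) (x - y) = phase φ x y := by
        rw [phase_neg_left, sub_eq_add_neg, phase_add_left, phase_neg_left]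
        simp
      simp only [Equiv.subRight_apply, op_apply, shift_apply, h2, h3, sub_neg_eq_add,
        sub_add_cancel, ContinuousMap.star_apply, map_star, inner_smul_left, inner_smul_right]
      rw [← star_phase φ x y]
      rw [ContinuousLinearMap.star_eq_adjoint, ContinuousLinearMap.adjoint_inner_left]
      simp)

theorem rep_mono (ω : X) (y : Fin d → ℤ) (f : MatFun N X) :
    rep ω (mono y f : CovPoly N φ X) = op φ ω y f := repLin_mono ω y f

theorem rep_single (ω : X) (x : Fin d → ℤ) (v : EuclideanSpace ℂ (Fin N)) (a : CovPoly N φ X) :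
    (rep ω a (lp.single 2 (-x) v)) 0 = Mat.act (coeff x a ω) v := by
  induction a using induction with
  | h0 => simp
  | hadd a b ha hb => simp [ha, hb]
  | hmono y f =>
    rw [rep_mono, op_apply]
    by_cases h : y = x
    · subst h
      rw [coeff_mono_same, zero_sub, lp.single_apply_self]
      simp
    · rw [coeff_mono_ne h, zero_sub, lp.single_apply_ne]
      · simp
      · simpa using h

/-- The coefficients are contractive for the universal norm. -/
theorem norm_coeff_le (x : Fin d → ℤ) (a : CovPoly N φ X) : ‖coeff x a‖ ≤ ‖a‖ := by
  refine (ContinuousMap.norm_le _ (norm_nonneg a)).2 fun ω => ?_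
  have h1 : ‖rep ω a‖ ≤ ‖a‖ := le_univ ((CStarSeminorm.ofNorm _).comap (rep ω)) a
  refine le_trans ?_ h1
  rw [← Mat.norm_act]
  refine ContinuousLinearMap.opNorm_le_bound _ (norm_nonneg _) fun v => ?_
  rw [← rep_single]
  refine (lp.norm_apply_le_norm (by norm_num) _ _).trans ?_
  refine (ContinuousLinearMap.le_opNorm _ _).trans ?_
  rw [lp.norm_single (by norm_num)]

end CovPoly

namespace CovPoly

variable {N φ X}

/-- The character `λ^{-x} = ∏ⱼ λⱼ^{-xⱼ}`. -/
def weight (l : Fin d → Circle) (x : Fin d → ℤ) : Circle := ∏ j, (l j)⁻¹ ^ x j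

theorem weight_add (l : Fin d → Circle) (x y : Fin d → ℤ) :
    weight l (x + y) = weight l x * weight l y := by
  simp [weight, zpow_add, Finset.prod_mul_distrib]

theorem weight_zero (l : Fin d → Circle) : weight l 0 = 1 := by simp [weight]

theorem weight_neg (l : Fin d → Circle) (x : Fin d → ℤ) : weight l (-x) = (weight l x)⁻¹ := by
  rw [eq_inv_iff_mul_eq_one, ← weight_add, neg_add_cancel, weight_zero]

/-- The torus action on polynomials, `f ↦ f` and `uⱼ ↦ λⱼ⁻¹ uⱼ`. -/
def torusAct (l : Fin d → Circle) : CovPoly N φ X →⋆ₐ[ℂ] CovPoly N φ X :=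
  homMk (lift fun x => (weight l x : ℂ) • mono x)
    (by simp [one_def, weight_zero])
    (fun x f y g => by
      rw [mono_mul_mono]
      simp only [lift_mono, LinearMap.smul_apply]
      rw [smul_mul_smul_comm, mono_mul_mono, weight_add, Circle.coe_mul])
    (fun x f => by
      rw [star_mono]
      simp only [lift_mono, LinearMap.smul_apply]
      rw [star_smul, star_mono, weight_neg, Circle.coe_inv_eq_conj]
      rfl)

theorem torusAct_mono (l : Fin d → Circle) (x : Fin d → ℤ) (f : MatFun N X) :
    torusAct l (mono x f : CovPoly N φ X) = (weight l x : ℂ) • mono x f := by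
  simp [torusAct]

/-- Composition of the coefficients with a continuous equivariant map `Y → X`. -/
def pull {Y : Type*} [TopologicalSpace Y] [CompactSpace Y] [AddAction (Fin d → ℤ) Y]
    [ContinuousConstVAdd (Fin d → ℤ) Y] (r : C(Y, X))
    (hr : ∀ (y : Fin d → ℤ) (η : Y), r (y +ᵥ η) = y +ᵥ r η) :
    CovPoly N φ X →⋆ₐ[ℂ] CovPoly N φ Y :=
  homMk (lift fun x => (mono x).comp
      (ContinuousMap.compStarAlgHom' ℂ (Mat N) r).toAlgHom.toLinearMap)
    (by
      simp [one_def])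
    (fun x f y g => by
      rw [mono_mul_mono, lift_mono, lift_mono, lift_mono]
      simp only [LinearMap.comp_apply, AlgHom.toLinearMap_apply]
      rw [mono_mul_mono]
      congr 1
      ext1 η
      simp [hr])
    (fun x f => by
      rw [star_mono, lift_mono, lift_mono]
      simp only [LinearMap.comp_apply, AlgHom.toLinearMap_apply]
      rw [star_mono]
      congr 1
      ext1 η
      simp [hr])

theorem pull_mono {Y : Type*} [TopologicalSpace Y] [CompactSpace Y] [AddAction (Fin d → ℤ) Y]
    [ContinuousConstVAdd (Fin d → ℤ) Y] (r : C(Y, X))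
    (hr : ∀ (y : Fin d → ℤ) (η : Y), r (y +ᵥ η) = y +ᵥ r η) (x : Fin d → ℤ) (f : MatFun N X) :
    pull r hr (mono x f : CovPoly N φ X) = mono x (f.comp r) := by
  simp [pull]

end CovPoly

/-! ### Fourier and differential calculus -/

namespace ObsAlg

variable {N φ X}

open UniformSpace

/-- The Fourier coefficient `aₓ ∈ C_N(X)`: the continuous extension of `∑ₓ aₓ uₓ ↦ aₓ`. -/
def coeff (x : Fin d → ℤ) : ObsAlg N φ X → MatFun N X :=
  Completion.extension (CovPoly.coeff (N := N) (φ := φ) (X := X) x)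

theorem coeff_of (x : Fin d → ℤ) (a : CovPoly N φ X) :
    coeff x (of a) = CovPoly.coeff x a := by
  refine Completion.extension_coe ?_ a
  refine (LipschitzWith.of_dist_le_mul (K := 1) fun a b => ?_).uniformContinuous
  rw [dist_eq_norm, dist_eq_norm, ← map_sub]
  simpa using CovPoly.norm_coeff_le x (a - b)

theorem continuous_coeff (x : Fin d → ℤ) :
    Continuous (coeff x : ObsAlg N φ X → MatFun N X) := Completion.continuous_extension

/-- The torus action `ρ_λ`, determined by `uⱼ ↦ λⱼ⁻¹ uⱼ`. -/
def torusAct (l : Fin d → Circle) : ObsAlg N φ X →⋆ₐ[ℂ] ObsAlg N φ X := map (CovPoly.torusAct l)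

/-- The torus action in angular coordinates, `t ↦ ρ_{(e^{i t₁}, …, e^{i t_d})}(a)`. -/
def orbit (a : ObsAlg N φ X) (t : Fin d → ℝ) : ObsAlg N φ X :=
  torusAct (fun j => Circle.exp (t j)) a

open scoped ContDiff in
/-- Membership in the smooth algebra `𝒜^∞`: `λ ↦ ρ_λ(a)` is infinitely differentiable. -/
def IsSmooth (a : ObsAlg N φ X) : Prop := ContDiff ℝ ∞ (orbit a)

/-- The derivation `∂ⱼ`, the generator of the torus action in the `j`-th direction. -/
def pderiv (j : Fin d) (a : ObsAlg N φ X) : ObsAlg N φ X :=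
  deriv (fun t : ℝ => orbit a (Pi.single j t)) 0

/-- `∂^α = ∂₁^{α₁} ⋯ ∂_d^{α_d}`. -/
def multiDeriv (α : Fin d → ℕ) (a : ObsAlg N φ X) : ObsAlg N φ X :=
  (List.finRange d).foldr (fun j b => (pderiv j)^[α j] b) a

/-- The functional calculus `G(h)`, for `h` self-adjoint and `G : ℝ → ℂ`. -/
def funCalc (G : ℝ → ℂ) (h : ObsAlg N φ X) : ObsAlg N φ X := cfc (fun z : ℂ => G z.re) h

/-- The trace `𝒯(a) = ∫ tr(a₀(ω)) dμ(ω)`. -/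
def trace [MeasurableSpace X] (μ : Measure X) (a : ObsAlg N φ X) : ℂ :=
  ∫ ω, Mat.tr (coeff 0 a ω) ∂μ

/-- The correlation function `𝒯(∂^{α₁} G₁(h) ⋯ ∂^{αₙ} Gₙ(h))`. -/
def correlation [MeasurableSpace X] (μ : Measure X) {n : ℕ} (α : Fin n → Fin d → ℕ)
    (G : Fin n → ℝ → ℂ) (h : ObsAlg N φ X) : ℂ :=
  trace μ (List.ofFn fun i => multiDeriv (α i) (funCalc (G i) h)).prod

end ObsAlg

end Algebra

/-! ### Disorder configurations -/

/-- The configuration space `Ω = ∏_{x ∈ ℤ^d} Ω₀` with the product topology. -/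
def Config (d : ℕ) (Ω₀ : Type*) : Type _ := (Fin d → ℤ) → Ω₀

namespace Config

variable {Ω₀ : Type*}

instance [TopologicalSpace Ω₀] : TopologicalSpace (Config d Ω₀) :=
  inferInstanceAs (TopologicalSpace ((Fin d → ℤ) → Ω₀))

instance [TopologicalSpace Ω₀] [CompactSpace Ω₀] : CompactSpace (Config d Ω₀) :=
  inferInstanceAs (CompactSpace ((Fin d → ℤ) → Ω₀))

instance [TopologicalSpace Ω₀] [T2Space Ω₀] : T2Space (Config d Ω₀) :=
  inferInstanceAs (T2Space ((Fin d → ℤ) → Ω₀))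

/-- The product `σ`-algebra. -/
instance [MeasurableSpace Ω₀] : MeasurableSpace (Config d Ω₀) :=
  inferInstanceAs (MeasurableSpace ((Fin d → ℤ) → Ω₀))

/-- The shift action `(τ_y ω)ₓ = ω_{x-y}`. -/
instance : AddAction (Fin d → ℤ) (Config d Ω₀) where
  vadd y ω := fun x => ω (x - y)
  zero_vadd ω := funext fun x => congrArg ω (sub_zero x)
  add_vadd y z ω := funext fun x => congrArg ω (by abel)

theorem vadd_apply (y : Fin d → ℤ) (ω : Config d Ω₀) (x : Fin d → ℤ) :
    (y +ᵥ ω) x = ω (x - y) := rfl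

instance [TopologicalSpace Ω₀] : ContinuousConstVAdd (Fin d → ℤ) (Config d Ω₀) where
  continuous_const_vadd y := continuous_pi fun x => continuous_apply (x - y)

/-- The relabelling `{ωₓ} ↦ {ω_{r(x)}}` of the sites. -/
def relabel (r : Equiv.Perm (Fin d → ℤ)) (ω : Config d Ω₀) : Config d Ω₀ := fun x => ω (r x)

end Config

/-- The `(2L+1)`-periodic configurations, `τ_j^{2L+1} ω = ω` for all `j`. -/
def PeriodicConfig (d : ℕ) (Ω₀ : Type*) (L : ℕ) : Type _ :=
  {ω : Config d Ω₀ // ∀ j : Fin d, ((2 * L + 1) • (Pi.single j 1 : Fin d → ℤ)) +ᵥ ω = ω}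

namespace PeriodicConfig

variable {Ω₀ : Type*} {L : ℕ}

instance [TopologicalSpace Ω₀] : TopologicalSpace (PeriodicConfig d Ω₀ L) :=
  inferInstanceAs (TopologicalSpace (Subtype _))

/-- The `σ`-algebra induced from the configuration space. -/
instance [MeasurableSpace Ω₀] : MeasurableSpace (PeriodicConfig d Ω₀ L) :=
  inferInstanceAs (MeasurableSpace (Subtype _))

instance [TopologicalSpace Ω₀] [CompactSpace Ω₀] [T2Space Ω₀] :
    CompactSpace (PeriodicConfig d Ω₀ L) := by
  refine isCompact_iff_compactSpace.1 (IsClosed.isCompact (X := Config d Ω₀) ?_)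
  change IsClosed {ω : Config d Ω₀ |
    ∀ j : Fin d, ((2 * L + 1) • (Pi.single j 1 : Fin d → ℤ)) +ᵥ ω = ω}
  rw [Set.ofPred_forall]
  exact isClosed_iInter fun j => isClosed_eq (continuous_const_vadd _) continuous_id

/-- The restriction of the shift action to the periodic configurations. -/
instance : AddAction (Fin d → ℤ) (PeriodicConfig d Ω₀ L) where
  vadd y ω := ⟨y +ᵥ ω.1, fun j => by rw [vadd_comm, ω.2 j]⟩
  zero_vadd ω := Subtype.ext (zero_vadd _ ω.1)
  add_vadd y z ω := Subtype.ext (add_vadd y z ω.1)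

instance [TopologicalSpace Ω₀] :
    ContinuousConstVAdd (Fin d → ℤ) (PeriodicConfig d Ω₀ L) where
  continuous_const_vadd y :=
    ((continuous_const_vadd y).comp continuous_subtype_val).subtype_mk _

/-- The inclusion of the periodic configurations. -/
def incl [TopologicalSpace Ω₀] : C(PeriodicConfig d Ω₀ L, Config d Ω₀) :=
  ⟨Subtype.val, continuous_subtype_val⟩

end PeriodicConfig

namespace Config

variable {Ω₀ : Type*}

/-- The map `𝔮̃ : Ω → Ω̃`: the periodic configuration that agrees with `ω` on `{-L, …, L}^d`. Here
`Int.bmod m (2L+1)` is the representative of `m` modulo `2L+1` in `{-L, …, L}`. -/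
def periodize (L : ℕ) (ω : Config d Ω₀) : PeriodicConfig d Ω₀ L :=
  ⟨fun x => ω fun j => Int.bmod (x j) (2 * L + 1), fun j => by
    funext x
    change ω (fun i => Int.bmod ((x - (2 * L + 1) • (Pi.single j 1 : Fin d → ℤ)) i) (2 * L + 1)) =
      ω fun i => Int.bmod (x i) (2 * L + 1)
    congr 1
    funext i
    by_cases h : i = j
    · subst h
      have : (x - (2 * L + 1) • (Pi.single i 1 : Fin d → ℤ)) i = x i - ((2 * L + 1 : ℕ) : ℤ) := by
        simp
      rw [this, Int.sub_bmod_right]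
    · simp [h]⟩

theorem periodize_apply (L : ℕ) (ω : Config d Ω₀) (x : Fin d → ℤ)
    (hx : ∀ j, -(L : ℤ) ≤ x j ∧ x j ≤ L) : (periodize L ω).1 x = ω x := by
  change ω _ = ω x
  congr 1
  funext j
  have := hx j
  rw [Int.bmod_eq_of_le] <;> omega

/-- The push-forward measure `𝔮̃_* μ` on the periodic configurations. -/
def periodicMeasure [MeasurableSpace Ω₀] (L : ℕ) (μ : Measure (Config d Ω₀)) :
    Measure (PeriodicConfig d Ω₀ L) := μ.map (periodize L)

end Config

/-- The epimorphism `𝔭̃ : 𝒜_d → 𝒜̃_d`, which restricts the Fourier coefficients to the periodic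
configurations. -/
def ObsAlg.toPeriodic {N : ℕ} {φ : Flux d} {Ω₀ : Type*} [TopologicalSpace Ω₀] [CompactSpace Ω₀]
    [T2Space Ω₀] (L : ℕ) :
    ObsAlg N φ (Config d Ω₀) →⋆ₐ[ℂ] ObsAlg N φ (PeriodicConfig d Ω₀ L) :=
  ObsAlg.map (CovPoly.pull PeriodicConfig.incl fun _ _ => rfl)

/-- The cube `V_M = {-M, …, M}^d`. -/
def cube (d M : ℕ) : Finset (Fin d → ℤ) := Fintype.piFinset fun _ => Finset.Icc (-(M : ℤ)) M

/-- The Fourier coefficients of `a` are localized: for every `K` there is `A > 0` such that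
`‖aₓ(ω) - aₓ(ω')‖ ≤ A / (1 + |V_M|)^K` for all `x` whenever `ω = ω'` on `V_M`. -/
def ObsAlg.IsLocalized {N : ℕ} {φ : Flux d} {Ω₀ : Type*} [TopologicalSpace Ω₀] [CompactSpace Ω₀]
    (a : ObsAlg N φ (Config d Ω₀)) : Prop :=
  ∀ K : ℕ, ∃ A : ℝ, 0 < A ∧ ∀ (x : Fin d → ℤ) (M : ℕ) (ω ω' : Config d Ω₀),
    (∀ y ∈ cube d M, ω y = ω' y) →
      ‖ObsAlg.coeff x a ω - ObsAlg.coeff x a ω'‖ ≤ A / (1 + ((cube d M).card : ℝ)) ^ K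

open scoped ContDiff in
/-- `G` is smooth over the set `S`: it coincides on `S` with a smooth function on `ℝ`. For
compact `S` this includes every function that is smooth on a neighbourhood of `S`. -/
def SmoothOver (S : Set ℝ) (G : ℝ → ℂ) : Prop :=
  ∃ g : ℝ → ℂ, ContDiff ℝ ∞ g ∧ Set.EqOn g G S

/-- The standing assumptions on the disorder measure: a probability measure with full topological
support, invariant and ergodic for the shift action, and invariant under all permutations of the
lattice sites. -/
structure IsDisorderMeasure {Ω₀ : Type*} [TopologicalSpace Ω₀] [MeasurableSpace Ω₀]
    (μ : Measure (Config d Ω₀)) : Prop where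
  isProbabilityMeasure : IsProbabilityMeasure μ
  isOpenPosMeasure : μ.IsOpenPosMeasure
  ergodic : ErgodicVAdd (Fin d → ℤ) (Config d Ω₀) μ
  map_relabel : ∀ r : Equiv.Perm (Fin d → ℤ), μ.map (Config.relabel r) = μ

end NCBT

end

noncomputable section

namespace NCBT

open scoped ContDiff
open UniformSpace

namespace ObsAlg

variable {d N : ℕ} {φ : Flux d} {X : Type*} [TopologicalSpace X] [CompactSpace X]
  [AddAction (Fin d → ℤ) X] [ContinuousConstVAdd (Fin d → ℤ) X]

/-! ### Fourier coefficients as continuous linear maps -/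

/-! The idea is to express locality inside an algebra of the same kind. On `Config d Ω₀ × Config d
Ω₀` with the diagonal shift, the two projections induce `*`-homomorphisms `pairFst` and `pairSnd`
from `𝒜_d`. Their difference `pairDiff` has coefficients `aₓ(ω) - aₓ(ω')` and obeys a twisted
Leibniz rule (`pairDiff_mul`). Dependence on remote sites becomes a decay estimate for `pairDiff a`
at pairs that agree on `‖z‖ < M` (`LocBound`). An element is tame if it is smooth and satisfies such
an estimate to every order in `1 + M`. The length `L` does not enter, so all constants are uniform
in it.

Tame elements are stable under every operation in the correlation function. For products, the
convolution formula evaluates the second factor at a shifted pair; a shift by `y` shrinks the region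
of agreement by at most `‖y‖`, and the rapid decay of the coefficients of a smooth element pays for
this (`LocBound.mul_left`, `LocBound.mul_right`). For derivatives, locality and smoothness are
interpolated (`IsTame.pderiv`).

For `G(h)`, cutting off and periodizing a smooth representative of `G` gives `G(h) = ∑ₖ cₖ Uᵏ` with
`U = exp(i t h)` unitary and `cₖ` rapidly decreasing. Because `‖U^{±1}‖ ≤ 1`, the derivative norms
and locality constants of `Uᵏ` grow only polynomially in `|k|` (`diffNorm_pow_le_of_norm_le_one`,
`IsTame.exists_locBound_pow`), so the series converges in all the relevant seminorms
(`isTame_of_hasSum_exp`).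

Finally, `𝔭̃_L` commutes with products, derivations and the functional calculus. Both correlations
are therefore traces of one tame element `a` and of its restriction. They differ by the integral of
`tr(a₀(ω) - a₀(𝔮̃_L ω))`, and `ω` and `𝔮̃_L ω` agree on `V_L` (`IsTame.norm_trace_sub_le`). -/

theorem coeff_add (x : Fin d → ℤ) (a b : ObsAlg N φ X) :
    coeff x (a + b) = coeff x a + coeff x b := by
  induction a using induction with
  | hp => exact isClosed_eq ((continuous_coeff x).comp (continuous_add_const b))
            ((continuous_add_const _).comp (continuous_coeff x))
  | h a =>
    induction b using induction with
    | hp => exact isClosed_eq ((continuous_coeff x).comp (continuous_const_add (of a)))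
              ((continuous_const_add _).comp (continuous_coeff x))
    | h b => rw [← of_add, coeff_of, coeff_of, coeff_of, _root_.map_add]

theorem coeff_smul (x : Fin d → ℤ) (c : ℂ) (a : ObsAlg N φ X) :
    coeff x (c • a) = c • coeff x a := by
  induction a using induction with
  | hp => exact isClosed_eq ((continuous_coeff x).comp (continuous_const_smul c))
            ((continuous_const_smul c).comp (continuous_coeff x))
  | h a => rw [← of_smul, coeff_of, coeff_of, _root_.map_smul]

theorem norm_coeff_le (x : Fin d → ℤ) (a : ObsAlg N φ X) : ‖coeff x a‖ ≤ ‖a‖ := by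
  induction a using induction with
  | hp => exact isClosed_le (continuous_norm.comp (continuous_coeff x)) continuous_norm
  | h a => rw [coeff_of, norm_of]; exact CovPoly.norm_coeff_le x a

/-- The Fourier coefficient as a continuous linear map. -/
def coeffL (x : Fin d → ℤ) : ObsAlg N φ X →L[ℂ] MatFun N X where
  toFun := coeff x
  map_add' := coeff_add x
  map_smul' := coeff_smul x
  cont := continuous_coeff x

@[simp] theorem coeffL_apply (x : Fin d → ℤ) (a : ObsAlg N φ X) : coeffL x a = coeff x a := rfl

theorem coeff_sub (x : Fin d → ℤ) (a b : ObsAlg N φ X) :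
    coeff x (a - b) = coeff x a - coeff x b := _root_.map_sub (coeffL x) a b

section map

variable {d' N' : ℕ} {φ' : Flux d'} {Y : Type*} [TopologicalSpace Y] [CompactSpace Y]
    [AddAction (Fin d' → ℤ) Y] [ContinuousConstVAdd (Fin d' → ℤ) Y]
    (F : CovPoly N φ X →⋆ₐ[ℂ] CovPoly N' φ' Y)

theorem map_of (a : CovPoly N φ X) : map F (of a) = of (F a) := mapFun_of F a

theorem continuous_map : Continuous (map F) := continuous_mapFun F

theorem norm_map_le (a : ObsAlg N φ X) : ‖map F a‖ ≤ ‖a‖ :=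
  NonUnitalStarAlgHom.norm_apply_le (map F) a

/-- `map F` as a continuous linear map. -/
def mapL : ObsAlg N φ X →L[ℂ] ObsAlg N' φ' Y :=
  ⟨(map F).toAlgHom.toLinearMap, continuous_map F⟩

@[simp] theorem mapL_apply (a : ObsAlg N φ X) : mapL F a = map F a := rfl

end map

section pull

variable {Y : Type*} [TopologicalSpace Y] [CompactSpace Y] [AddAction (Fin d → ℤ) Y]
    [ContinuousConstVAdd (Fin d → ℤ) Y] (r : C(Y, X))
    (hr : ∀ (y : Fin d → ℤ) (η : Y), r (y +ᵥ η) = y +ᵥ r η)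

theorem coeff_map_pull (x : Fin d → ℤ) (a : ObsAlg N φ X) :
    coeff x (map (CovPoly.pull r hr) a) = (coeff x a).comp r := by
  induction a using induction with
  | hp => exact isClosed_eq ((continuous_coeff x).comp (continuous_map _))
            ((ContinuousMap.continuous_precomp r).comp (continuous_coeff x))
  | h a =>
    rw [map_of, coeff_of, coeff_of]
    induction a using CovPoly.induction with
    | h0 => ext1; simp
    | hadd a b ha hb => rw [_root_.map_add, _root_.map_add, ha, hb, _root_.map_add]; rfl
    | hmono y f =>
      rw [CovPoly.pull_mono]
      by_cases h : y = x
      · subst h; rw [CovPoly.coeff_mono_same, CovPoly.coeff_mono_same]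
      · rw [CovPoly.coeff_mono_ne h, CovPoly.coeff_mono_ne h]; rfl

end pull

/-! ### The torus action -/

theorem torusAct_of (l : Fin d → Circle) (a : CovPoly N φ X) :
    torusAct l (of a) = of (CovPoly.torusAct l a) := map_of _ a

theorem continuous_torusAct (l : Fin d → Circle) :
    Continuous (torusAct l : ObsAlg N φ X → ObsAlg N φ X) := continuous_map _

theorem torusAct_torusAct (l m : Fin d → Circle) (a : ObsAlg N φ X) :
    torusAct l (torusAct m a) = torusAct (l * m) a := by
  induction a using induction with
  | hp => exact isClosed_eq ((continuous_torusAct l).comp (continuous_torusAct m))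
            (continuous_torusAct _)
  | h a =>
    rw [torusAct_of, torusAct_of, torusAct_of]
    congr 1
    induction a using CovPoly.induction with
    | h0 => simp
    | hadd a b ha hb => simp only [_root_.map_add, ha, hb]
    | hmono y f =>
      rw [CovPoly.torusAct_mono, _root_.map_smul, CovPoly.torusAct_mono, CovPoly.torusAct_mono,
        smul_smul]
      congr 1
      rw [← Circle.coe_mul]
      congr 1
      simp only [CovPoly.weight, mul_zpow, Finset.prod_mul_distrib, Pi.mul_apply, mul_inv]
      exact mul_comm _ _

theorem torusAct_one (a : ObsAlg N φ X) : torusAct 1 a = a := by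
  induction a using induction with
  | hp => exact isClosed_eq (continuous_torusAct 1) continuous_id
  | h a =>
    rw [torusAct_of]
    congr 1
    induction a using CovPoly.induction with
    | h0 => simp
    | hadd a b ha hb => simp only [_root_.map_add, ha, hb]
    | hmono y f => rw [CovPoly.torusAct_mono]; simp [CovPoly.weight]

theorem norm_torusAct (l : Fin d → Circle) (a : ObsAlg N φ X) : ‖torusAct l a‖ = ‖a‖ := by
  refine le_antisymm (norm_map_le _ a) ?_
  calc ‖a‖ = ‖torusAct l⁻¹ (torusAct l a)‖ := by
        rw [torusAct_torusAct, inv_mul_cancel, torusAct_one]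
    _ ≤ _ := norm_map_le _ _

/-- The torus action as a real-linear isometry. -/
def torusIso (l : Fin d → Circle) : ObsAlg N φ X →ₗᵢ[ℝ] ObsAlg N φ X :=
  ⟨(torusAct l).toAlgHom.toLinearMap.restrictScalars ℝ, norm_torusAct l⟩

@[simp] theorem torusIso_apply (l : Fin d → Circle) (a : ObsAlg N φ X) :
    torusIso l a = torusAct l a := rfl

theorem coeff_torusAct (l : Fin d → Circle) (x : Fin d → ℤ) (a : ObsAlg N φ X) :
    coeff x (torusAct l a) = (CovPoly.weight l x : ℂ) • coeff x a := by
  induction a using induction with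
  | hp => exact isClosed_eq ((continuous_coeff x).comp (continuous_torusAct l))
            ((continuous_const_smul _).comp (continuous_coeff x))
  | h a =>
    rw [torusAct_of, coeff_of, coeff_of]
    induction a using CovPoly.induction with
    | h0 => simp
    | hadd a b ha hb => simp only [_root_.map_add, ha, hb, smul_add]
    | hmono y f =>
      rw [CovPoly.torusAct_mono, _root_.map_smul]
      by_cases h : y = x
      · subst h; rfl
      · rw [CovPoly.coeff_mono_ne h, smul_zero, smul_zero]

theorem orbit_zero (a : ObsAlg N φ X) : orbit a 0 = a := by
  have : (fun j => Circle.exp ((0 : Fin d → ℝ) j)) = 1 := by ext j; simp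
  rw [orbit, this, torusAct_one]

/-- By the group law, a translation of the parameter is an isometry of the algebra, so the behaviour
of an orbit at `0` determines it everywhere. -/
theorem orbit_add (a : ObsAlg N φ X) (s t : Fin d → ℝ) :
    orbit a (s + t) = torusIso (fun j => Circle.exp (s j)) (orbit a t) := by
  rw [torusIso_apply, orbit, orbit, torusAct_torusAct]
  congr 2
  funext j
  simp [Circle.exp_add]

theorem orbit_mul (a b : ObsAlg N φ X) : orbit (a * b) = orbit a * orbit b := by
  funext t; simp [orbit]

theorem orbit_one : orbit (1 : ObsAlg N φ X) = 1 := by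
  funext t; simp [orbit]

theorem orbit_smul (c : ℂ) (a : ObsAlg N φ X) : orbit (c • a) = c • orbit a := by
  funext t; simp [orbit]

theorem coeff_orbit_single (j : Fin d) (s : ℝ) (x : Fin d → ℤ) (a : ObsAlg N φ X) :
    coeff x (orbit a (Pi.single j s)) = Complex.exp (-(x j * s) * Complex.I) • coeff x a := by
  rw [orbit, coeff_torusAct]
  congr 1
  rw [CovPoly.weight, Finset.prod_eq_single j]
  · rw [Pi.single_eq_same, ← Circle.exp_neg, Circle.coe_zpow, Circle.coe_exp, ← Complex.exp_int_mul]
    congr 1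
    push_cast
    ring
  · intro i _ hi
    simp [Pi.single_eq_of_ne hi]
  · simp

theorem map_pull_torusAct {Y : Type*} [TopologicalSpace Y] [CompactSpace Y]
    [AddAction (Fin d → ℤ) Y] [ContinuousConstVAdd (Fin d → ℤ) Y] (r : C(Y, X))
    (hr : ∀ (y : Fin d → ℤ) (η : Y), r (y +ᵥ η) = y +ᵥ r η) (l : Fin d → Circle)
    (a : ObsAlg N φ X) :
    map (CovPoly.pull r hr) (torusAct l a) = torusAct l (map (CovPoly.pull r hr) a) := by
  induction a using induction with
  | hp => exact isClosed_eq ((continuous_map _).comp (continuous_torusAct l))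
            ((continuous_torusAct l).comp (continuous_map _))
  | h a =>
    rw [torusAct_of, map_of, map_of, torusAct_of]
    congr 1
    induction a using CovPoly.induction with
    | h0 => simp
    | hadd a b ha hb => simp only [_root_.map_add, ha, hb]
    | hmono y f =>
      rw [CovPoly.torusAct_mono, _root_.map_smul, CovPoly.pull_mono, CovPoly.torusAct_mono]

theorem map_pull_orbit {Y : Type*} [TopologicalSpace Y] [CompactSpace Y]
    [AddAction (Fin d → ℤ) Y] [ContinuousConstVAdd (Fin d → ℤ) Y] (r : C(Y, X))
    (hr : ∀ (y : Fin d → ℤ) (η : Y), r (y +ᵥ η) = y +ᵥ r η)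
    (a : ObsAlg N φ X) (t : Fin d → ℝ) :
    map (CovPoly.pull r hr) (orbit a t) = orbit (map (CovPoly.pull r hr) a) t :=
  map_pull_torusAct r hr _ a

/-! ### Smooth elements and the derivations -/

theorem IsSmooth.mul {a b : ObsAlg N φ X} (ha : a.IsSmooth) (hb : b.IsSmooth) :
    (a * b).IsSmooth := by
  rw [IsSmooth, orbit_mul]
  exact ContDiff.mul ha hb

theorem isSmooth_one : (1 : ObsAlg N φ X).IsSmooth := by
  rw [IsSmooth, orbit_one]
  exact contDiff_const

theorem IsSmooth.smul {a : ObsAlg N φ X} (ha : a.IsSmooth) (c : ℂ) : (c • a).IsSmooth := by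
  rw [IsSmooth, orbit_smul]
  exact ContDiff.const_smul c ha

theorem IsSmooth.pow {a : ObsAlg N φ X} (ha : a.IsSmooth) (n : ℕ) : (a ^ n).IsSmooth := by
  induction n with
  | zero => rw [pow_zero]; exact isSmooth_one
  | succ n ih => rw [pow_succ]; exact ih.mul ha

theorem IsSmooth.map_pull {Y : Type*} [TopologicalSpace Y] [CompactSpace Y]
    [AddAction (Fin d → ℤ) Y] [ContinuousConstVAdd (Fin d → ℤ) Y] (r : C(Y, X))
    (hr : ∀ (y : Fin d → ℤ) (η : Y), r (y +ᵥ η) = y +ᵥ r η) {a : ObsAlg N φ X}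
    (ha : a.IsSmooth) : (map (CovPoly.pull r hr) a).IsSmooth := by
  have : orbit (map (CovPoly.pull r hr) a) =
      ((mapL (CovPoly.pull r hr)).restrictScalars ℝ) ∘ orbit a := by
    funext t
    exact (map_pull_orbit r hr a t).symm
  rw [IsSmooth, this]
  exact (ContinuousLinearMap.contDiff _).comp ha

theorem IsSmooth.hasDerivAt_orbit {a : ObsAlg N φ X} (ha : a.IsSmooth) (j : Fin d) :
    HasDerivAt (fun t : ℝ => orbit a (Pi.single j t)) (fderiv ℝ (orbit a) 0 (Pi.single j 1)) 0 := by
  have h1 : HasFDerivAt (orbit a) (fderiv ℝ (orbit a) 0) (Pi.single j (0 : ℝ)) := by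
    rw [Pi.single_zero]
    exact ((ContDiff.differentiable ha (by simp)) 0).hasFDerivAt
  have h2 : HasDerivAt (fun t : ℝ => (Pi.single j t : Fin d → ℝ)) (Pi.single j 1) 0 :=
    ((ContinuousLinearMap.single ℝ (fun _ : Fin d => ℝ) j).hasDerivAt (x := (0:ℝ)))
  exact h1.comp_hasDerivAt 0 h2

theorem IsSmooth.pderiv_eq {a : ObsAlg N φ X} (ha : a.IsSmooth) (j : Fin d) :
    pderiv j a = fderiv ℝ (orbit a) 0 (Pi.single j 1) :=
  (ha.hasDerivAt_orbit j).deriv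

/-- The isometry `ρ_t` is linear and passes through the derivative at `0`. Hence the orbit of `∂ⱼ a`
is a directional derivative of a smooth map, which makes `∂ⱼ a` smooth again. -/
theorem IsSmooth.orbit_pderiv {a : ObsAlg N φ X} (ha : a.IsSmooth) (j : Fin d)
    (t : Fin d → ℝ) : orbit (pderiv j a) t = fderiv ℝ (orbit a) t (Pi.single j 1) := by
  have hd : Differentiable ℝ (orbit a) := ContDiff.differentiable ha (by simp)
  have h1 : (fun s => orbit a (t + s)) =
      fun s => torusIso (fun j => Circle.exp (t j)) (orbit a s) := funext (orbit_add a t)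
  have h2 : fderiv ℝ (fun s => orbit a (t + s)) 0 = fderiv ℝ (orbit a) t := by
    rw [fderiv_comp_add_left, add_zero]
  have h3 : fderiv ℝ (fun s => torusIso (N := N) (φ := φ) (X := X)
      (fun j => Circle.exp (t j)) (orbit a s)) 0 =
      (torusIso (fun j => Circle.exp (t j))).toContinuousLinearMap.comp (fderiv ℝ (orbit a) 0) :=
    ((torusIso (fun j => Circle.exp (t j))).toContinuousLinearMap.hasFDerivAt.comp 0
      (hd 0).hasFDerivAt).fderiv
  rw [← h2, h1, h3, ha.pderiv_eq]
  rfl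

theorem IsSmooth.pderiv {a : ObsAlg N φ X} (ha : a.IsSmooth) (j : Fin d) :
    (pderiv j a).IsSmooth := by
  rw [IsSmooth, funext (ha.orbit_pderiv j)]
  exact (ContDiff.fderiv_right (m := ∞) ha (by simp)).clm_apply contDiff_const

/-- The coefficient of the orbit is the scalar `e^{-i xⱼ s}` times `aₓ`; differentiating at `s = 0`
in the two possible ways gives the formula. -/
theorem IsSmooth.coeff_pderiv {a : ObsAlg N φ X} (ha : a.IsSmooth) (j : Fin d)
    (x : Fin d → ℤ) : coeff x (ObsAlg.pderiv j a) = (-(x j) * Complex.I) • coeff x a := by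
  have h1 := ((coeffL (N := N) (φ := φ) (X := X) x).restrictScalars ℝ).hasFDerivAt.comp_hasDerivAt
    (0 : ℝ) (ha.hasDerivAt_orbit j)
  rw [← ha.pderiv_eq] at h1
  have h2 : HasDerivAt (fun s : ℝ => Complex.exp (-(x j * s) * Complex.I) • coeff x a)
      ((-(x j) * Complex.I) • coeff x a) 0 := by
    have h3 : HasDerivAt (fun s : ℝ => Complex.exp (-(x j * s) * Complex.I))
        (-(x j) * Complex.I) 0 := by
      have h4 : HasDerivAt (fun s : ℂ => -(x j * s) * Complex.I) (-(x j) * Complex.I)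
          ((0 : ℝ) : ℂ) := by
        simpa using (((hasDerivAt_id ((0 : ℝ) : ℂ)).const_mul (x j : ℂ)).neg.mul_const Complex.I)
      simpa using h4.cexp.comp_ofReal
    exact h3.smul_const _
  have h5 : (fun s : ℝ => Complex.exp (-(x j * s) * Complex.I) • coeff x a) =
      ((coeffL (N := N) (φ := φ) (X := X) x).restrictScalars ℝ) ∘
        fun t : ℝ => orbit a (Pi.single j t) := by
    funext s
    exact (coeff_orbit_single j s x a).symm
  rw [h5] at h2
  exact h1.unique h2

theorem IsSmooth.map_pull_pderiv {Y : Type*} [TopologicalSpace Y] [CompactSpace Y]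
    [AddAction (Fin d → ℤ) Y] [ContinuousConstVAdd (Fin d → ℤ) Y] (r : C(Y, X))
    (hr : ∀ (y : Fin d → ℤ) (η : Y), r (y +ᵥ η) = y +ᵥ r η) {a : ObsAlg N φ X}
    (ha : a.IsSmooth) (j : Fin d) :
    map (CovPoly.pull r hr) (ObsAlg.pderiv j a) =
      ObsAlg.pderiv j (map (CovPoly.pull r hr) a) := by
  have h1 := ((mapL (CovPoly.pull (N := N) (φ := φ) r hr)).restrictScalars
    ℝ).hasFDerivAt.comp_hasDerivAt (0 : ℝ) (ha.hasDerivAt_orbit j)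
  have h2 : ((mapL (CovPoly.pull (N := N) (φ := φ) r hr)).restrictScalars ℝ) ∘
      (fun t : ℝ => orbit a (Pi.single j t)) =
      fun t : ℝ => orbit (map (CovPoly.pull r hr) a) (Pi.single j t) := by
    funext t
    exact map_pull_orbit r hr a _
  rw [h2] at h1
  rw [ha.pderiv_eq]
  exact h1.deriv.symm

end ObsAlg

end NCBT

end

noncomputable section

namespace NCBT

open scoped ContDiff
open UniformSpace

namespace ObsAlg

variable {d N : ℕ} {φ : Flux d} {X : Type*} [TopologicalSpace X] [CompactSpace X]
  [AddAction (Fin d → ℤ) X] [ContinuousConstVAdd (Fin d → ℤ) X]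

/-! ### The seminorms of the smooth algebra -/

/-- The algebra is zero when `N = 0` or `X` is empty, so only an inequality is available. -/
theorem norm_one_le : ‖(1 : ObsAlg N φ X)‖ ≤ 1 := by
  rcases subsingleton_or_nontrivial (ObsAlg N φ X) with h | h
  · rw [Subsingleton.elim (1 : ObsAlg N φ X) 0, norm_zero]; exact zero_le_one
  · exact CStarRing.norm_one.le

/-- The norm of the `m`-th total derivative of the torus orbit. -/
def diffNorm (m : ℕ) (a : ObsAlg N φ X) : ℝ := ‖iteratedFDeriv ℝ m (orbit a) 0‖

theorem diffNorm_nonneg (m : ℕ) (a : ObsAlg N φ X) : 0 ≤ diffNorm m a := norm_nonneg _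

theorem diffNorm_zero_left (a : ObsAlg N φ X) : diffNorm 0 a = ‖a‖ := by
  rw [diffNorm, norm_iteratedFDeriv_zero, orbit_zero]

/-- The torus acts by isometries, so derivative norms are constant along an orbit. A bound on
`diffNorm` is thereby uniform in `t`. -/
theorem IsSmooth.norm_iteratedFDeriv_orbit {a : ObsAlg N φ X} (ha : a.IsSmooth) (m : ℕ)
    (t : Fin d → ℝ) : ‖iteratedFDeriv ℝ m (orbit a) t‖ = diffNorm m a := by
  have h1 : (fun s => orbit a (t + s)) =
      torusIso (fun j => Circle.exp (t j)) ∘ orbit a := funext (orbit_add a t)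
  have h2 := iteratedFDeriv_comp_add_left (𝕜 := ℝ) (f := orbit a) m t 0
  rw [add_zero] at h2
  rw [← h2, h1, LinearIsometry.norm_iteratedFDeriv_comp_left _
    (ContDiff.contDiffAt ha) (by exact_mod_cast le_top), diffNorm]

theorem diffNorm_mul_le {a b : ObsAlg N φ X} (ha : a.IsSmooth) (hb : b.IsSmooth) (m : ℕ) :
    diffNorm m (a * b) ≤
      ∑ i ∈ Finset.range (m + 1), (m.choose i : ℝ) * diffNorm i a * diffNorm (m - i) b := by
  rw [diffNorm, orbit_mul]
  exact norm_iteratedFDeriv_mul_le ha hb 0 (by exact_mod_cast le_top)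

theorem IsSmooth.diffNorm_pderiv_le {a : ObsAlg N φ X} (ha : a.IsSmooth) (j : Fin d) (m : ℕ) :
    diffNorm m (ObsAlg.pderiv j a) ≤ diffNorm (m + 1) a := by
  let ev : ((Fin d → ℝ) →L[ℝ] ObsAlg N φ X) →L[ℝ] ObsAlg N φ X :=
    ContinuousLinearMap.apply ℝ _ (Pi.single j (1 : ℝ) : Fin d → ℝ)
  have h1 : orbit (ObsAlg.pderiv j a) = ev ∘ fderiv ℝ (orbit a) := funext (ha.orbit_pderiv j)
  have h2 : ‖ev‖ ≤ 1 := by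
    refine ContinuousLinearMap.opNorm_le_bound _ zero_le_one fun T => ?_
    refine (T.le_opNorm _).trans ?_
    rw [Pi.norm_single, norm_one, mul_one, one_mul]
  have h3 : ContDiff ℝ ∞ (fderiv ℝ (orbit a)) := ContDiff.fderiv_right (m := ∞) ha (by simp)
  rw [diffNorm, h1, diffNorm, ← norm_iteratedFDeriv_fderiv]
  refine (ev.norm_iteratedFDeriv_comp_left h3.contDiffAt
    (by exact_mod_cast le_top)).trans ?_
  exact mul_le_of_le_one_left (norm_nonneg _) h2

/-- Each `∂ⱼ` multiplies the coefficient by `-i xⱼ`, and coefficients are contractive; smoothness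
thus forces rapid decay in `x`. -/
theorem IsSmooth.abs_pow_mul_norm_coeff_le {a : ObsAlg N φ X} (ha : a.IsSmooth) (j : Fin d)
    (x : Fin d → ℤ) (m : ℕ) : |(x j : ℝ)| ^ m * ‖coeff x a‖ ≤ diffNorm m a := by
  induction m generalizing a with
  | zero => rw [pow_zero, one_mul, diffNorm_zero_left]; exact norm_coeff_le x a
  | succ m ih =>
    refine le_trans (le_of_eq ?_) ((ih (ha.pderiv j)).trans (ha.diffNorm_pderiv_le j m))
    rw [ha.coeff_pderiv, norm_smul, norm_mul, norm_neg, Complex.norm_I, mul_one,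
      Complex.norm_intCast, pow_succ, mul_assoc]

theorem exists_norm_eq_abs (x : Fin d → ℤ) : ‖x‖ = 0 ∨ ∃ j, ‖x‖ = |(x j : ℝ)| := by
  rcases isEmpty_or_nonempty (Fin d) with h | h
  · left; rw [Subsingleton.elim x 0, norm_zero]
  · right
    obtain ⟨j, -, hj⟩ := Finset.exists_mem_eq_sup' Finset.univ_nonempty fun i => ‖x i‖₊
    refine ⟨j, ?_⟩
    rw [Pi.norm_def, ← Finset.sup'_eq_sup Finset.univ_nonempty, hj, coe_nnnorm, Int.norm_eq_abs]

theorem IsSmooth.weight_mul_norm_coeff_le {a : ObsAlg N φ X} (ha : a.IsSmooth)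
    (x : Fin d → ℤ) (m : ℕ) :
    (1 + ‖x‖) ^ m * ‖coeff x a‖ ≤ 2 ^ m * (‖a‖ + diffNorm m a) := by
  have h1 : (1 + ‖x‖) ^ m ≤ 2 ^ m * (1 + ‖x‖ ^ m) := by
    rcases le_total ‖x‖ 1 with h | h
    · calc (1 + ‖x‖) ^ m ≤ 2 ^ m := pow_le_pow_left₀ (by positivity) (by linarith) m
        _ ≤ 2 ^ m * (1 + ‖x‖ ^ m) :=
          le_mul_of_one_le_right (by positivity) (by linarith [pow_nonneg (norm_nonneg x) m])
    · calc (1 + ‖x‖) ^ m ≤ (2 * ‖x‖) ^ m := pow_le_pow_left₀ (by positivity) (by linarith) m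
        _ = 2 ^ m * ‖x‖ ^ m := mul_pow _ _ _
        _ ≤ _ := by gcongr; linarith
  have h2 : ‖x‖ ^ m * ‖coeff x a‖ ≤ diffNorm m a := by
    rcases exists_norm_eq_abs x with h | ⟨j, h⟩
    · rw [h]
      -- Here `‖x‖ = 0`; the order `m = 0` is separate because `0 ^ 0 = 1`.
      rcases m with _ | m
      · rw [pow_zero, one_mul, diffNorm_zero_left]; exact norm_coeff_le x a
      · rw [zero_pow (by simp), zero_mul]; exact diffNorm_nonneg _ _
    · rw [h]; exact ha.abs_pow_mul_norm_coeff_le j x m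
  calc (1 + ‖x‖) ^ m * ‖coeff x a‖ ≤ 2 ^ m * (1 + ‖x‖ ^ m) * ‖coeff x a‖ := by gcongr
    _ = 2 ^ m * (‖coeff x a‖ + ‖x‖ ^ m * ‖coeff x a‖) := by ring
    _ ≤ _ := by gcongr; exact norm_coeff_le x a

/-- In the Leibniz rule for `u^k * u`, the only term of full order on `u^k` carries the factor `‖u‖
≤ 1` and does not grow. The other terms have lower order on `u^k` and are polynomial in `k` by
induction. Summing over `k` raises the degree by one. -/
theorem diffNorm_pow_le_of_norm_le_one {u : ObsAlg N φ X} (hu : u.IsSmooth) (h1 : ‖u‖ ≤ 1)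
    (m : ℕ) : ∃ C : ℝ, 0 ≤ C ∧ ∀ k : ℕ, diffNorm m (u ^ k) ≤ C * (1 + k) ^ m := by
  induction m using Nat.strong_induction_on with
  | _ m ih =>
    rcases m with _ | m
    · refine ⟨1, zero_le_one, fun k => ?_⟩
      rw [diffNorm_zero_left, pow_zero, mul_one]
      induction k with
      | zero => rw [pow_zero]; exact norm_one_le
      | succ k ihk =>
        rw [pow_succ]
        exact (norm_mul_le _ _).trans (mul_le_one₀ ihk (norm_nonneg _) h1)
    · choose! C hC0 hC using ih
      -- `E (1 + k)^m` bounds all Leibniz terms of order at most `m` on `u^k`.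
      set E := ∑ i ∈ Finset.range (m + 1), ((m + 1).choose i : ℝ) * C i * diffNorm (m + 1 - i) u
        with hE
      have hE0 : 0 ≤ E := Finset.sum_nonneg fun i hi =>
        mul_nonneg (mul_nonneg (by positivity) (hC0 i (Finset.mem_range.1 hi)))
          (diffNorm_nonneg _ _)
      have hF0 : 0 ≤ diffNorm (m + 1) (1 : ObsAlg N φ X) := diffNorm_nonneg _ _
      refine ⟨diffNorm (m + 1) (1 : ObsAlg N φ X) + E, by positivity, fun k => ?_⟩
      induction k with
      | zero => simpa using hE0
      | succ k ihk =>
        have h2 := diffNorm_mul_le (hu.pow k) hu (m + 1)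
        rw [Finset.sum_range_succ, Nat.choose_self, Nat.sub_self, diffNorm_zero_left,
          Nat.cast_one, one_mul, ← pow_succ] at h2
        have h3 : ∑ i ∈ Finset.range (m + 1),
            ((m + 1).choose i : ℝ) * diffNorm i (u ^ k) * diffNorm (m + 1 - i) u ≤
            E * (1 + k) ^ m := by
          rw [hE, Finset.sum_mul]
          refine Finset.sum_le_sum fun i hi => ?_
          have hi' := Finset.mem_range.1 hi
          have h4 : diffNorm i (u ^ k) ≤ C i * (1 + k) ^ m :=
            (hC i hi' k).trans (mul_le_mul_of_nonneg_left
              (pow_le_pow_right₀ (by linarith [Nat.cast_nonneg (α := ℝ) k]) (by omega))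
              (hC0 i hi'))
          calc _ ≤ ((m + 1).choose i : ℝ) * (C i * (1 + k) ^ m) * diffNorm (m + 1 - i) u := by
                gcongr; exact diffNorm_nonneg _ _
            _ = _ := by ring
        have h5 : diffNorm (m + 1) (u ^ k) * ‖u‖ ≤ diffNorm (m + 1) (u ^ k) :=
          mul_le_of_le_one_right (diffNorm_nonneg _ _) h1
        -- The left side is `(1 + k)^m (2 + k)`; this inequality closes the recursion.
        have h6 : (1 + (k : ℝ)) ^ (m + 1) + (1 + (k : ℝ)) ^ m ≤ (1 + ((k + 1 : ℕ) : ℝ)) ^ (m + 1) := by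
          rw [pow_succ, pow_succ]
          have : (1 + (k : ℝ)) ^ m ≤ (1 + ((k + 1 : ℕ) : ℝ)) ^ m := by
            gcongr; linarith
          have h7 : (0 : ℝ) ≤ 1 + ((k + 1 : ℕ) : ℝ) := by positivity
          calc _ = (1 + (k : ℝ)) ^ m * (1 + ((k + 1 : ℕ) : ℝ)) := by push_cast; ring
            _ ≤ _ := mul_le_mul_of_nonneg_right this h7
        have h8 : (0 : ℝ) ≤ (1 + (k : ℝ)) ^ m := by positivity
        nlinarith [mul_le_mul_of_nonneg_left h6 (add_nonneg hF0 hE0), mul_nonneg hF0 h8]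

/-- Geometric growth is all that holds without `‖a‖ ≤ 1`, and it suffices against the factorials of
the exponential series. The factor `2 ^ m` in `R` comes from the sum of the binomial coefficients.
-/
theorem diffNorm_pow_le {a : ObsAlg N φ X} (ha : a.IsSmooth) (m : ℕ) :
    ∃ F R : ℝ, 0 ≤ F ∧ 0 ≤ R ∧ ∀ n i : ℕ, i ≤ m → diffNorm i (a ^ n) ≤ F * R ^ n := by
  set F := ∑ i ∈ Finset.range (m + 1), diffNorm i (1 : ObsAlg N φ X) with hF
  set B := ∑ i ∈ Finset.range (m + 1), diffNorm i a with hB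
  have hF0 : 0 ≤ F := Finset.sum_nonneg fun _ _ => diffNorm_nonneg _ _
  have hB0 : 0 ≤ B := Finset.sum_nonneg fun _ _ => diffNorm_nonneg _ _
  refine ⟨F, 2 ^ m * B, hF0, by positivity, fun n => ?_⟩
  induction n with
  | zero =>
    intro i hi
    rw [pow_zero, pow_zero, mul_one]
    exact Finset.single_le_sum (f := fun i => diffNorm i (1 : ObsAlg N φ X))
      (fun _ _ => diffNorm_nonneg _ _) (Finset.mem_range.2 (by omega))
  | succ n ih =>
    intro i hi
    rw [pow_succ]
    refine (diffNorm_mul_le (ha.pow n) ha i).trans ?_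
    have h1 : ∀ l ∈ Finset.range (i + 1),
        (i.choose l : ℝ) * diffNorm l (a ^ n) * diffNorm (i - l) a ≤
          (i.choose l : ℝ) * (F * (2 ^ m * B) ^ n * B) := by
      intro l hl
      have hl' := Finset.mem_range.1 hl
      rw [mul_assoc]
      gcongr
      · exact diffNorm_nonneg _ _
      · exact ih l (by omega)
      · exact Finset.single_le_sum (f := fun i => diffNorm i a)
          (fun _ _ => diffNorm_nonneg _ _) (Finset.mem_range.2 (by omega))
    refine (Finset.sum_le_sum h1).trans ?_
    rw [← Finset.sum_mul, ← Nat.cast_sum, Nat.sum_range_choose, pow_succ (2 ^ m * B)]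
    push_cast
    calc (2 : ℝ) ^ i * (F * (2 ^ m * B) ^ n * B) ≤ 2 ^ m * (F * (2 ^ m * B) ^ n * B) := by
          gcongr; norm_num
      _ = _ := by ring

end ObsAlg

end NCBT

end

noncomputable section

namespace NCBT

open UniformSpace

/-! ### Summable weights on the lattice -/

/-- A finite set of points lies in a box `t^d`, over which the sum factorizes into a `d`-th power.
-/
theorem summable_prod_of_nonneg {ι : Type*} {d : ℕ} {f : ι → ℝ} (h0 : ∀ i, 0 ≤ f i)
    (hf : Summable f) : Summable fun x : Fin d → ι => ∏ j, f (x j) := by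
  classical
  refine summable_of_sum_le (c := (∑' i, f i) ^ d)
    (fun x => Finset.prod_nonneg fun j _ => h0 _) fun s => ?_
  set t : Finset ι := Finset.univ.biUnion fun j : Fin d => s.image fun x => x j
  have hst : s ⊆ Fintype.piFinset fun _ : Fin d => t := by
    intro x hx
    rw [Fintype.mem_piFinset]
    intro j
    exact Finset.mem_biUnion.2 ⟨j, Finset.mem_univ _, Finset.mem_image_of_mem _ hx⟩
  refine (Finset.sum_le_sum_of_subset_of_nonneg hst
    fun x _ _ => Finset.prod_nonneg fun j _ => h0 _).trans ?_
  rw [← Finset.prod_univ_sum, Finset.prod_const, Finset.card_univ, Fintype.card_fin]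
  exact pow_le_pow_left₀ (Finset.sum_nonneg fun i _ => h0 i)
    (hf.sum_le_tsum t fun i _ => h0 i) d

theorem summable_one_add_norm_int : Summable fun n : ℤ => ((1 + ‖n‖) ^ 2)⁻¹ := by
  have h : Summable fun n : ℕ => ((1 + ‖(n : ℤ)‖) ^ 2)⁻¹ := by
    have := (summable_nat_add_iff 1).2 (Real.summable_nat_pow_inv.2 one_lt_two)
    refine this.congr fun n => ?_
    rw [Int.norm_natCast]
    push_cast
    ring
  exact Summable.of_nat_of_neg h (by simpa using h)

/-- The weights `(1 + ‖x‖)^{-2d}` are summable over `ℤ^d`. -/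
theorem summable_weight (d : ℕ) :
    Summable fun x : Fin d → ℤ => ((1 + ‖x‖) ^ (2 * d))⁻¹ := by
  refine Summable.of_nonneg_of_le (fun x => by positivity) (fun x => ?_)
    (summable_prod_of_nonneg (d := d) (fun n => by positivity) summable_one_add_norm_int)
  rw [Finset.prod_inv_distrib]
  refine inv_anti₀ (Finset.prod_pos fun j _ => by positivity) ?_
  rw [pow_mul]
  calc ∏ j, (1 + ‖x j‖) ^ 2 ≤ ∏ _j : Fin d, (1 + ‖x‖) ^ 2 :=
        Finset.prod_le_prod (fun j _ => by positivity) fun j _ => by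
          gcongr; exact norm_le_pi_norm x j
    _ = _ := by rw [Finset.prod_const, Finset.card_univ, Fintype.card_fin]

/-- The sum of the weights `(1 + ‖x‖)^{-2d}` over `ℤ^d`. -/
def weightSum (d : ℕ) : ℝ := ∑' x : Fin d → ℤ, ((1 + ‖x‖) ^ (2 * d))⁻¹

theorem weightSum_nonneg (d : ℕ) : 0 ≤ weightSum d := tsum_nonneg fun x => by positivity

namespace ObsAlg

variable {d N : ℕ} {φ : Flux d} {X : Type*} [TopologicalSpace X] [CompactSpace X]
  [AddAction (Fin d → ℤ) X] [ContinuousConstVAdd (Fin d → ℤ) X]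

/-! ### The convolution formula for the coefficients of a product -/

theorem uniformContinuous_rep (ω : X) :
    UniformContinuous (CovPoly.rep ω : CovPoly N φ X → (Hil N d →L[ℂ] Hil N d)) := by
  refine (LipschitzWith.of_dist_le_mul (K := 1) fun a b => ?_).uniformContinuous
  rw [dist_eq_norm, dist_eq_norm, ← _root_.map_sub, NNReal.coe_one, one_mul]
  exact CovPoly.le_univ ((CStarSeminorm.ofNorm _).comap (CovPoly.rep ω)) (a - b)

/-- The canonical representation `π_ω` of the completed algebra. -/
def rep (ω : X) : ObsAlg N φ X → (Hil N d →L[ℂ] Hil N d) :=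
  Completion.extension (CovPoly.rep (N := N) (φ := φ) ω)

theorem rep_of (ω : X) (a : CovPoly N φ X) : rep ω (of a) = CovPoly.rep ω a :=
  Completion.extension_coe (uniformContinuous_rep ω) a

theorem continuous_rep (ω : X) : Continuous (rep ω : ObsAlg N φ X → _) :=
  Completion.continuous_extension

theorem rep_mul (ω : X) (a b : ObsAlg N φ X) : rep ω (a * b) = rep ω a * rep ω b := by
  induction a using induction with
  | hp => exact isClosed_eq ((continuous_rep ω).comp (continuous_mul_const b))
            ((continuous_mul_const _).comp (continuous_rep ω))
  | h a =>
    induction b using induction with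
    | hp => exact isClosed_eq ((continuous_rep ω).comp (continuous_const_mul (of a)))
              ((continuous_const_mul _).comp (continuous_rep ω))
    | h b => rw [← of_mul, rep_of, rep_of, rep_of, map_mul]

/-- Evaluation of a vector in `ℓ²(ℤ^d; ℂ^N)` at a site. -/
def evalSite (y : Fin d → ℤ) : Hil N d →L[ℂ] EuclideanSpace ℂ (Fin N) :=
  lp.evalCLM ℂ (fun _ : Fin d → ℤ => EuclideanSpace ℂ (Fin N)) 2 y

@[simp] theorem evalSite_apply (y : Fin d → ℤ) (ψ : Hil N d) : evalSite y ψ = ψ y := rfl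

/-- Each matrix entry of `π_ω(a)` sees a single Fourier coefficient, so coefficients of products can
be computed by matrix multiplication. -/
theorem rep_single (ω : X) (a : ObsAlg N φ X) (z y : Fin d → ℤ) (v : EuclideanSpace ℂ (Fin N)) :
    (rep ω a (lp.single 2 z v)) y =
      phase φ (y - z) y • Mat.act (coeff (y - z) a (y +ᵥ ω)) v := by
  induction a using induction with
  | hp =>
    refine isClosed_eq ?_ ?_
    · have h1 : Continuous fun a : ObsAlg N φ X => rep ω a (lp.single 2 z v) :=
        (ContinuousLinearMap.apply ℂ (Hil N d) (lp.single 2 z v : Hil N d)).continuous.comp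
          (continuous_rep ω)
      exact (evalSite y).continuous.comp h1
    · have h1 : Continuous fun a : ObsAlg N φ X => coeff (y - z) a (y +ᵥ ω) :=
        (continuous_eval_const _).comp (continuous_coeff _)
      have h2 : Continuous (Mat.act (N := N)) :=
        (AddMonoidHomClass.isometry_of_norm Mat.act Mat.norm_act).continuous
      exact ((h2.comp h1).clm_apply (continuous_const (y := v))).const_smul (phase φ (y - z) y)
  | h a =>
    rw [rep_of, coeff_of]
    induction a using CovPoly.induction with
    | h0 => simp
    | hadd a b ha hb => simp [ha, hb]
    | hmono w f =>
      rw [CovPoly.rep_mono, CovPoly.op_apply]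
      by_cases h : w = y - z
      · subst h
        rw [CovPoly.coeff_mono_same, sub_sub_cancel, lp.single_apply_self]
      · rw [CovPoly.coeff_mono_ne h, lp.single_apply_ne]
        · simp
        · intro h'
          apply h
          rw [← h']
          abel

/-- The Fourier series of an element need not converge in norm. The convolution is therefore read
off on vectors: `π_ω(b)` applied to a vector at the site `-x` is expanded over sites in `ℓ²`, then
`π_ω(a)` and evaluation at `0` are applied termwise. -/
theorem hasSum_coeff_mul (a b : ObsAlg N φ X) (x : Fin d → ℤ) (ω : X)
    (v : EuclideanSpace ℂ (Fin N)) :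
    HasSum (fun y : Fin d → ℤ => Mat.act (coeff (-y) a ω)
      (phase φ (y + x) y • Mat.act (coeff (y + x) b (y +ᵥ ω)) v))
      (Mat.act (coeff x (a * b) ω) v) := by
  have h1 := (lp.hasSum_single (p := 2) (by norm_num)
    (rep ω b (lp.single 2 (-x) v))).mapL ((evalSite 0).comp (rep ω a))
  have h2 : ((evalSite 0).comp (rep ω a)) (rep ω b (lp.single 2 (-x) v)) =
      Mat.act (coeff x (a * b) ω) v := by
    have := rep_single ω (a * b) (-x) 0 v
    rw [rep_mul] at this
    simpa using this
  rw [h2] at h1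
  refine h1.congr_fun fun y => ?_
  rw [ContinuousLinearMap.comp_apply, evalSite_apply, rep_single, rep_single]
  simp

/-- The bound is pointwise in `ω`, because locality concerns particular pairs of configurations and
not the sup norm. -/
theorem norm_coeff_mul_apply_le (a b : ObsAlg N φ X) (x : Fin d → ℤ) (ω : X)
    {f : (Fin d → ℤ) → ℝ} (hf : Summable f)
    (h : ∀ y, ‖coeff (-y) a ω‖ * ‖coeff (y + x) b (y +ᵥ ω)‖ ≤ f y) :
    ‖coeff x (a * b) ω‖ ≤ ∑' y, f y := by
  have hf0 : ∀ y, 0 ≤ f y := fun y => (mul_nonneg (norm_nonneg _) (norm_nonneg _)).trans (h y)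
  rw [← Mat.norm_act]
  refine ContinuousLinearMap.opNorm_le_bound _ (tsum_nonneg hf0) fun v => ?_
  rw [← (hasSum_coeff_mul a b x ω v).tsum_eq, ← tsum_mul_right]
  refine tsum_of_norm_bounded (hf.mul_right ‖v‖).hasSum fun y => ?_
  refine (ContinuousLinearMap.le_opNorm _ _).trans ?_
  rw [Mat.norm_act, norm_smul, norm_phase, one_mul]
  calc ‖coeff (-y) a ω‖ * ‖Mat.act (coeff (y + x) b (y +ᵥ ω)) v‖
      ≤ ‖coeff (-y) a ω‖ * (‖coeff (y + x) b (y +ᵥ ω)‖ * ‖v‖) := by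
        gcongr
        rw [← Mat.norm_act]
        exact ContinuousLinearMap.le_opNorm _ _
    _ ≤ _ := by
        rw [← mul_assoc]
        exact mul_le_mul_of_nonneg_right (h y) (norm_nonneg _)

end ObsAlg

end NCBT

end

noncomputable section

set_option linter.unusedSectionVars false

namespace NCBT

open UniformSpace

/-! ### Pairs of configurations -/

theorem exists_nat_norm_eq {d : ℕ} (x : Fin d → ℤ) : ∃ n : ℕ, ‖x‖ = n := by
  rcases ObsAlg.exists_norm_eq_abs x with h | ⟨j, h⟩
  · exact ⟨0, by rw [h, Nat.cast_zero]⟩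
  · exact ⟨(x j).natAbs, by rw [h, Nat.cast_natAbs, Int.cast_abs]⟩

/-- The two configurations agree on the sites of norm less than `M`. -/
def AgreeBelow {d : ℕ} {Ω₀ : Type*} (M : ℕ) (η : Config d Ω₀ × Config d Ω₀) : Prop :=
  ∀ z : Fin d → ℤ, ‖z‖ < M → η.1 z = η.2 z

/-- Since `M = 0` imposes no condition, `LocBound` contains a uniform bound on all coefficients. -/
theorem agreeBelow_zero {d : ℕ} {Ω₀ : Type*} (η : Config d Ω₀ × Config d Ω₀) :
    AgreeBelow 0 η := fun z hz => absurd (norm_nonneg z) (by rw [Nat.cast_zero] at hz; exact not_le.2 hz)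

/-- A shift by `y` brings a disagreement closer to the origin by at most `‖y‖`, so `M' = max (M -
‖y‖) 0` works. -/
theorem AgreeBelow.vadd {d : ℕ} {Ω₀ : Type*} {M : ℕ} {η : Config d Ω₀ × Config d Ω₀}
    (h : AgreeBelow M η) (y : Fin d → ℤ) :
    ∃ M' : ℕ, AgreeBelow M' (y +ᵥ η) ∧ 1 + (M : ℝ) ≤ (1 + ‖y‖) * (1 + M') := by
  obtain ⟨n, hn⟩ := exists_nat_norm_eq y
  rcases le_total n M with hnM | hnM
  · refine ⟨M - n, fun z hz => h (z - y) ?_, ?_⟩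
    · rw [Nat.cast_sub hnM] at hz
      have := norm_sub_le z y
      linarith
    · rw [hn, Nat.cast_sub hnM]
      have : (n : ℝ) ≤ M := by exact_mod_cast hnM
      nlinarith [Nat.cast_nonneg (α := ℝ) n]
  · refine ⟨0, agreeBelow_zero _, ?_⟩
    have : (M : ℝ) ≤ n := by exact_mod_cast hnM
    rw [hn]
    simpa using this

namespace ObsAlg

variable {d N : ℕ} {φ : Flux d} {Ω₀ : Type*} [TopologicalSpace Ω₀] [CompactSpace Ω₀]

/-- The coefficients at a pair of configurations that agree below `M` are at most
`C / (1 + M)^K`. -/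
def LocBound (K : ℕ) (C : ℝ) (c : ObsAlg N φ (Config d Ω₀ × Config d Ω₀)) : Prop :=
  ∀ (M : ℕ) (x : Fin d → ℤ) (η : Config d Ω₀ × Config d Ω₀), AgreeBelow M η →
    (1 + (M : ℝ)) ^ K * ‖coeff x c η‖ ≤ C

theorem LocBound.mono {K : ℕ} {C C' : ℝ} {c : ObsAlg N φ (Config d Ω₀ × Config d Ω₀)}
    (h : LocBound K C c) (hC : C ≤ C') : LocBound K C' c :=
  fun M x η hη => (h M x η hη).trans hC

theorem locBound_zero (K : ℕ) : LocBound K 0 (0 : ObsAlg N φ (Config d Ω₀ × Config d Ω₀)) :=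
  fun M x η _ => by
    rw [← coeffL_apply, _root_.map_zero, ContinuousMap.zero_apply, norm_zero, mul_zero]

theorem LocBound.add {K : ℕ} {C C' : ℝ} {c c' : ObsAlg N φ (Config d Ω₀ × Config d Ω₀)}
    (h : LocBound K C c) (h' : LocBound K C' c') : LocBound K (C + C') (c + c') :=
  fun M x η hη => by
    rw [coeff_add, ContinuousMap.add_apply]
    calc _ ≤ (1 + (M : ℝ)) ^ K * (‖coeff x c η‖ + ‖coeff x c' η‖) := by
          gcongr; exact norm_add_le _ _
      _ ≤ C + C' := by rw [mul_add]; exact add_le_add (h M x η hη) (h' M x η hη)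

theorem LocBound.smul {K : ℕ} {C : ℝ} {c : ObsAlg N φ (Config d Ω₀ × Config d Ω₀)}
    (h : LocBound K C c) (z : ℂ) : LocBound K (‖z‖ * C) (z • c) :=
  fun M x η hη => by
    rw [coeff_smul, ContinuousMap.smul_apply, norm_smul, mul_left_comm]
    exact mul_le_mul_of_nonneg_left (h M x η hη) (norm_nonneg z)

theorem LocBound.sum {ι : Type*} (s : Finset ι) {K : ℕ} {C : ι → ℝ}
    {c : ι → ObsAlg N φ (Config d Ω₀ × Config d Ω₀)} (h : ∀ i ∈ s, LocBound K (C i) (c i)) :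
    LocBound K (∑ i ∈ s, C i) (∑ i ∈ s, c i) := by
  classical
  induction s using Finset.induction_on with
  | empty => exact locBound_zero K
  | insert i s hi ih =>
    rw [Finset.sum_insert hi, Finset.sum_insert hi]
    exact (h i (Finset.mem_insert_self i s)).add
      (ih fun j hj => h j (Finset.mem_insert_of_mem hj))

theorem LocBound.nonneg {K : ℕ} {C : ℝ} {c : ObsAlg N φ (Config d Ω₀ × Config d Ω₀)}
    (h : LocBound K C c) (η : Config d Ω₀ × Config d Ω₀) : 0 ≤ C :=
  le_trans (by positivity) (h 0 0 η (agreeBelow_zero η))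

theorem LocBound.hasSum {ι : Type*} {K : ℕ} {C : ι → ℝ}
    {c : ι → ObsAlg N φ (Config d Ω₀ × Config d Ω₀)} {s : ObsAlg N φ (Config d Ω₀ × Config d Ω₀)}
    (hs : HasSum c s) (hC : Summable C) (h : ∀ i, LocBound K (C i) (c i)) :
    LocBound K (∑' i, C i) s := fun M x η hη => by
  have h1 : HasSum (fun i => coeff x (c i) η) (coeff x s η) :=
    (hs.mapL (coeffL x)).map (ContinuousMap.coeFnAddMonoidHom.comp (AddMonoidHom.id _) |>
      (Pi.evalAddMonoidHom (fun _ => Mat N) η).comp) (continuous_eval_const η)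
  have hpos : (0 : ℝ) < (1 + (M : ℝ)) ^ K := by positivity
  rw [← h1.tsum_eq, mul_comm, ← le_div_iff₀ hpos, ← tsum_div_const]
  refine tsum_of_norm_bounded (hC.div_const _).hasSum fun i => ?_
  rw [le_div_iff₀ hpos, mul_comm]
  exact h i M x η hη

/-- In the convolution `c` is evaluated at the shifted pair `y +ᵥ η`. The resulting loss `(1 +
‖y‖)^K` is paid by the decay of `a`, and the remaining `2 * d` powers make the sum over `y`
converge. -/
theorem LocBound.mul_left {K : ℕ} {B C : ℝ} {a c : ObsAlg N φ (Config d Ω₀ × Config d Ω₀)}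
    (h : LocBound K C c) (ha : ∀ x, (1 + ‖x‖) ^ (K + 2 * d) * ‖coeff x a‖ ≤ B) :
    LocBound K (B * C * weightSum d) (a * c) := fun M x η hη => by
  have hpos : (0 : ℝ) < (1 + (M : ℝ)) ^ K := by positivity
  have hB : 0 ≤ B := le_trans (by positivity) (ha 0)
  rw [mul_comm, ← le_div_iff₀ hpos, weightSum, ← tsum_mul_left, ← tsum_div_const]
  refine norm_coeff_mul_apply_le a c x η
    (((summable_weight d).mul_left (B * C)).div_const _) fun y => ?_
  obtain ⟨M', hM', hle⟩ := hη.vadd y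
  have h1 : (1 + ‖y‖) ^ (K + 2 * d) * ‖coeff (-y) a η‖ ≤ B := by
    refine le_trans ?_ (ha (-y))
    rw [norm_neg]
    gcongr
    exact ContinuousMap.norm_coe_le_norm _ _
  have h2 := h M' (y + x) _ hM'
  have h3 : (1 + (M : ℝ)) ^ K ≤ (1 + ‖y‖) ^ K * (1 + (M' : ℝ)) ^ K := by
    rw [← mul_pow]; gcongr
  rw [le_div_iff₀ hpos, ← div_eq_mul_inv, le_div_iff₀ (by positivity)]
  calc ‖coeff (-y) a η‖ * ‖coeff (y + x) c (y +ᵥ η)‖ * (1 + (M : ℝ)) ^ K * (1 + ‖y‖) ^ (2 * d)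
      ≤ ‖coeff (-y) a η‖ * ‖coeff (y + x) c (y +ᵥ η)‖ * ((1 + ‖y‖) ^ K * (1 + (M' : ℝ)) ^ K) *
        (1 + ‖y‖) ^ (2 * d) := by gcongr
    _ = ((1 + ‖y‖) ^ (K + 2 * d) * ‖coeff (-y) a η‖) *
        ((1 + (M' : ℝ)) ^ K * ‖coeff (y + x) c (y +ᵥ η)‖) := by rw [pow_add]; ring
    _ ≤ B * C := mul_le_mul h1 h2 (by positivity) hB

/-- Here `c` is evaluated at `η` itself, so no agreement is lost and `b` only has to make the sum
converge. The weights are reindexed by `y ↦ y + x`. -/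
theorem LocBound.mul_right {K : ℕ} {B C : ℝ} {b c : ObsAlg N φ (Config d Ω₀ × Config d Ω₀)}
    (h : LocBound K C c) (hb : ∀ x, (1 + ‖x‖) ^ (2 * d) * ‖coeff x b‖ ≤ B) :
    LocBound K (C * B * weightSum d) (c * b) := fun M x η hη => by
  have hpos : (0 : ℝ) < (1 + (M : ℝ)) ^ K := by positivity
  rw [mul_comm, ← le_div_iff₀ hpos, weightSum,
    ← (Equiv.addRight x).tsum_eq fun y : Fin d → ℤ => ((1 + ‖y‖) ^ (2 * d))⁻¹, ← tsum_mul_left,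
    ← tsum_div_const]
  refine norm_coeff_mul_apply_le c b x η
    ((((Equiv.addRight x).summable_iff.2 (summable_weight d)).mul_left (C * B)).div_const _)
    fun y => ?_
  have h1 : (1 + ‖y + x‖) ^ (2 * d) * ‖coeff (y + x) b (y +ᵥ η)‖ ≤ B := by
    refine le_trans ?_ (hb (y + x))
    gcongr
    exact ContinuousMap.norm_coe_le_norm _ _
  rw [Equiv.coe_addRight, le_div_iff₀ hpos, ← div_eq_mul_inv, le_div_iff₀ (by positivity)]
  calc _ = ((1 + (M : ℝ)) ^ K * ‖coeff (-y) c η‖) *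
        ((1 + ‖y + x‖) ^ (2 * d) * ‖coeff (y + x) b (y +ᵥ η)‖) := by ring
    _ ≤ C * B := mul_le_mul (h M (-y) η hη) h1 (by positivity) (h.nonneg η)

/-! ### The difference of the two restrictions -/

theorem fst_vadd (y : Fin d → ℤ) (η : Config d Ω₀ × Config d Ω₀) :
    (ContinuousMap.fst : C(Config d Ω₀ × Config d Ω₀, Config d Ω₀)) (y +ᵥ η) =
      y +ᵥ (ContinuousMap.fst : C(Config d Ω₀ × Config d Ω₀, Config d Ω₀)) η := rfl

theorem snd_vadd (y : Fin d → ℤ) (η : Config d Ω₀ × Config d Ω₀) :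
    (ContinuousMap.snd : C(Config d Ω₀ × Config d Ω₀, Config d Ω₀)) (y +ᵥ η) =
      y +ᵥ (ContinuousMap.snd : C(Config d Ω₀ × Config d Ω₀, Config d Ω₀)) η := rfl

/-- The projection `(ω, ω') ↦ ω` on observables. -/
def pairFst : ObsAlg N φ (Config d Ω₀) →⋆ₐ[ℂ] ObsAlg N φ (Config d Ω₀ × Config d Ω₀) :=
  map (CovPoly.pull ContinuousMap.fst fst_vadd)

/-- The projection `(ω, ω') ↦ ω'` on observables. -/
def pairSnd : ObsAlg N φ (Config d Ω₀) →⋆ₐ[ℂ] ObsAlg N φ (Config d Ω₀ × Config d Ω₀) :=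
  map (CovPoly.pull ContinuousMap.snd snd_vadd)

/-- The difference of the two restrictions, with coefficients `aₓ(ω) - aₓ(ω')`. -/
def pairDiff : ObsAlg N φ (Config d Ω₀) →L[ℂ] ObsAlg N φ (Config d Ω₀ × Config d Ω₀) :=
  mapL (CovPoly.pull ContinuousMap.fst fst_vadd) -
    mapL (CovPoly.pull ContinuousMap.snd snd_vadd)

theorem pairDiff_eq (a : ObsAlg N φ (Config d Ω₀)) : pairDiff a = pairFst a - pairSnd a := rfl

theorem coeff_pairDiff (a : ObsAlg N φ (Config d Ω₀)) (x : Fin d → ℤ)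
    (η : Config d Ω₀ × Config d Ω₀) :
    coeff x (pairDiff a) η = coeff x a η.1 - coeff x a η.2 := by
  rw [pairDiff_eq, pairFst, pairSnd, coeff_sub, coeff_map_pull, coeff_map_pull]
  rfl

theorem norm_coeff_pairFst_le (a : ObsAlg N φ (Config d Ω₀)) (x : Fin d → ℤ) :
    ‖coeff x (pairFst a)‖ ≤ ‖coeff x a‖ := by
  rw [pairFst, coeff_map_pull]
  exact (ContinuousMap.norm_le _ (norm_nonneg _)).2 fun η => (coeff x a).norm_coe_le_norm η.1

theorem norm_coeff_pairSnd_le (a : ObsAlg N φ (Config d Ω₀)) (x : Fin d → ℤ) :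
    ‖coeff x (pairSnd a)‖ ≤ ‖coeff x a‖ := by
  rw [pairSnd, coeff_map_pull]
  exact (ContinuousMap.norm_le _ (norm_nonneg _)).2 fun η => (coeff x a).norm_coe_le_norm η.2

/-- A difference of two homomorphisms is a twisted derivation; this is what allows locality to be
propagated algebraically. -/
theorem pairDiff_mul (a b : ObsAlg N φ (Config d Ω₀)) :
    pairDiff (a * b) = pairDiff a * pairFst b + pairSnd a * pairDiff b := by
  simp only [pairDiff_eq, map_mul]
  noncomm_ring

theorem pairDiff_one : pairDiff (1 : ObsAlg N φ (Config d Ω₀)) = 0 := by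
  rw [pairDiff_eq, map_one, map_one, sub_self]

/-- Telescoping form of the twisted Leibniz rule. It keeps the powers of `a` intact, so that bounds
on powers can be used instead of products of bounds. -/
theorem pairDiff_pow (a : ObsAlg N φ (Config d Ω₀)) (n : ℕ) :
    pairDiff (a ^ n) =
      ∑ i ∈ Finset.range n, pairSnd (a ^ i) * pairDiff a * pairFst (a ^ (n - 1 - i)) := by
  induction n with
  | zero => rw [pow_zero, pairDiff_one, Finset.sum_range_zero]
  | succ n ih =>
    rw [pow_succ, pairDiff_mul, ih, Finset.sum_range_succ, Finset.sum_mul, Nat.add_sub_cancel,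
      Nat.sub_self, pow_zero, map_one, mul_one]
    congr 1
    refine Finset.sum_congr rfl fun i hi => ?_
    rw [mul_assoc, ← map_mul, ← pow_succ]
    congr 3
    have := Finset.mem_range.1 hi
    omega

theorem locBound_pairDiff_mul {K : ℕ} {A B C C' : ℝ} {a b : ObsAlg N φ (Config d Ω₀)}
    (ha : LocBound K C (pairDiff a)) (hb : LocBound K C' (pairDiff b))
    (hA : ∀ x, (1 + ‖x‖) ^ (K + 2 * d) * ‖coeff x a‖ ≤ A)
    (hB : ∀ x, (1 + ‖x‖) ^ (2 * d) * ‖coeff x b‖ ≤ B) :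
    LocBound K (C * B * weightSum d + A * C' * weightSum d) (pairDiff (a * b)) := by
  rw [pairDiff_mul]
  refine (ha.mul_right fun x => le_trans ?_ (hB x)).add (hb.mul_left fun x => le_trans ?_ (hA x))
  · gcongr; exact norm_coeff_pairFst_le b x
  · gcongr; exact norm_coeff_pairSnd_le a x

theorem locBound_pairDiff_pow {K n : ℕ} {B C : ℝ} {a : ObsAlg N φ (Config d Ω₀)}
    (ha : LocBound K C (pairDiff a))
    (hB : ∀ i < n, ∀ x, (1 + ‖x‖) ^ (K + 2 * d) * ‖coeff x (a ^ i)‖ ≤ B) :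
    LocBound K (n * (B * C * weightSum d * B * weightSum d)) (pairDiff (a ^ n)) := by
  rw [pairDiff_pow]
  have h : ∀ i ∈ Finset.range n, LocBound K (B * C * weightSum d * B * weightSum d)
      (pairSnd (a ^ i) * pairDiff a * pairFst (a ^ (n - 1 - i))) := by
    intro i hi
    have hi' := Finset.mem_range.1 hi
    refine (ha.mul_left fun x => le_trans ?_ (hB i hi' x)).mul_right fun x =>
      le_trans ?_ (hB (n - 1 - i) (by omega) x)
    · gcongr; exact norm_coeff_pairSnd_le _ x
    · gcongr
      · linarith [norm_nonneg x]
      · omega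
      · exact norm_coeff_pairFst_le _ x
  simpa using LocBound.sum _ h

/-! ### Smooth localized elements -/

/-- Smooth elements whose coefficients depend rapidly little on remote sites. -/
structure IsTame (a : ObsAlg N φ (Config d Ω₀)) : Prop where
  isSmooth : a.IsSmooth
  exists_locBound : ∀ K : ℕ, ∃ C : ℝ, 0 ≤ C ∧ LocBound K C (pairDiff a)

theorem isTame_one : IsTame (1 : ObsAlg N φ (Config d Ω₀)) :=
  ⟨isSmooth_one, fun K => ⟨0, le_rfl, by rw [pairDiff_one]; exact locBound_zero K⟩⟩

theorem IsTame.mul {a b : ObsAlg N φ (Config d Ω₀)} (ha : IsTame a) (hb : IsTame b) :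
    IsTame (a * b) := by
  refine ⟨ha.isSmooth.mul hb.isSmooth, fun K => ?_⟩
  obtain ⟨C, hC0, hC⟩ := ha.exists_locBound K
  obtain ⟨C', hC0', hC'⟩ := hb.exists_locBound K
  have h1 := diffNorm_nonneg (2 * d) b
  have h2 := diffNorm_nonneg (K + 2 * d) a
  have h3 := weightSum_nonneg d
  exact ⟨_, by positivity, locBound_pairDiff_mul hC hC'
    (fun x => ha.isSmooth.weight_mul_norm_coeff_le x _)
    fun x => hb.isSmooth.weight_mul_norm_coeff_le x _⟩

theorem IsTame.smul {a : ObsAlg N φ (Config d Ω₀)} (ha : IsTame a) (c : ℂ) : IsTame (c • a) :=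
  ⟨ha.isSmooth.smul c, fun K => by
    obtain ⟨C, hC0, hC⟩ := ha.exists_locBound K
    exact ⟨‖c‖ * C, by positivity, by rw [_root_.map_smul]; exact hC.smul c⟩⟩

/-- The derivation introduces the unbounded factor `xⱼ`, while the locality bound has no decay in
`x`. Interpolation removes it: the square of the new coefficient is `xⱼ²` times the old one, bounded
by smoothness, times the old one, bounded by locality. -/
theorem IsTame.pderiv {a : ObsAlg N φ (Config d Ω₀)} (ha : IsTame a) (j : Fin d) :
    IsTame (pderiv j a) := by
  refine ⟨ha.isSmooth.pderiv j, fun K => ?_⟩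
  -- Order `2K`, because the square of the coefficient is estimated.
  obtain ⟨C, hC0, hC⟩ := ha.exists_locBound (K + K)
  have hD := diffNorm_nonneg 2 a
  refine ⟨√(2 * diffNorm 2 a * C), Real.sqrt_nonneg _, fun M x η hη => Real.le_sqrt_of_sq_le ?_⟩
  have h1 : coeff x (pairDiff (ObsAlg.pderiv j a)) η =
      (-(x j : ℂ) * Complex.I) • coeff x (pairDiff a) η := by
    rw [coeff_pairDiff, coeff_pairDiff, ha.isSmooth.coeff_pderiv, smul_sub]
    rfl
  have h2 : |(x j : ℝ)| ^ 2 * ‖coeff x (pairDiff a) η‖ ≤ 2 * diffNorm 2 a := by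
    have h3 : ‖coeff x (pairDiff a) η‖ ≤ 2 * ‖coeff x a‖ := by
      rw [coeff_pairDiff, two_mul]
      exact (norm_sub_le _ _).trans (add_le_add (ContinuousMap.norm_coe_le_norm _ _)
        (ContinuousMap.norm_coe_le_norm _ _))
    calc _ ≤ |(x j : ℝ)| ^ 2 * (2 * ‖coeff x a‖) := by gcongr
      _ = 2 * (|(x j : ℝ)| ^ 2 * ‖coeff x a‖) := by ring
      _ ≤ _ := by gcongr; exact ha.isSmooth.abs_pow_mul_norm_coeff_le j x 2
  rw [h1, norm_smul, norm_mul, norm_neg, Complex.norm_I, mul_one, Complex.norm_intCast]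
  calc _ = (|(x j : ℝ)| ^ 2 * ‖coeff x (pairDiff a) η‖) *
        ((1 + (M : ℝ)) ^ (K + K) * ‖coeff x (pairDiff a) η‖) := by rw [pow_add]; ring
    _ ≤ _ := mul_le_mul h2 (hC M x η hη) (by positivity) (by positivity)

theorem IsTame.multiDeriv {a : ObsAlg N φ (Config d Ω₀)} (ha : IsTame a) (α : Fin d → ℕ) :
    IsTame (multiDeriv α a) := by
  unfold ObsAlg.multiDeriv
  induction List.finRange d with
  | nil => exact ha
  | cons j l ih =>
    rw [List.foldr_cons]
    generalize α j = k
    induction k with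
    | zero => exact ih
    | succ k ihk => rw [Function.iterate_succ_apply']; exact ihk.pderiv j

theorem isTame_list_prod {l : List (ObsAlg N φ (Config d Ω₀))} (h : ∀ a ∈ l, IsTame a) :
    IsTame l.prod := by
  induction l with
  | nil => exact isTame_one
  | cons a l ih =>
    rw [List.prod_cons]
    exact (h a List.mem_cons_self).mul (ih fun b hb => h b (List.mem_cons_of_mem _ hb))

end ObsAlg

end NCBT

end

noncomputable section

set_option linter.unusedSectionVars false

namespace NCBT

open UniformSpace

namespace ObsAlg

/-! ### Exponentials -/

section Exp

variable {d N : ℕ} {φ : Flux d} {X : Type*} [TopologicalSpace X] [CompactSpace X]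
  [AddAction (Fin d → ℤ) X] [ContinuousConstVAdd (Fin d → ℤ) X]

theorem orbit_exp (a : ObsAlg N φ X) :
    orbit (NormedSpace.exp a) = NormedSpace.exp ∘ orbit a := by
  funext t
  let +nondep : NormedAlgebra ℚ (ObsAlg N φ X) := .restrictScalars ℚ ℂ _
  exact NormedSpace.map_exp (torusAct fun j => Circle.exp (t j)) (continuous_torusAct _) a

/-- The torus action commutes with `exp`, which is analytic on the whole Banach algebra. -/
theorem IsSmooth.exp {a : ObsAlg N φ X} (ha : a.IsSmooth) : (NormedSpace.exp a).IsSmooth := by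
  rw [IsSmooth, orbit_exp]
  refine ContDiff.comp ?_ ha
  have h : AnalyticOnNhd ℂ (NormedSpace.exp : ObsAlg N φ X → ObsAlg N φ X) Set.univ :=
    fun x _ => NormedSpace.exp_analytic x
  exact (contDiff_iff_contDiffAt.2 fun x => (h x (Set.mem_univ x)).contDiffAt).restrict_scalars ℝ

theorem exp_natCast_smul (b : ObsAlg N φ X) (n : ℕ) :
    NormedSpace.exp ((n : ℂ) • b) = NormedSpace.exp b ^ n := by
  let +nondep : NormedAlgebra ℚ (ObsAlg N φ X) := .restrictScalars ℚ ℂ _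
  rw [← NormedSpace.exp_nsmul, Nat.cast_smul_eq_nsmul]

theorem norm_exp_I_smul_le {a : ObsAlg N φ X} (ha : IsSelfAdjoint a) :
    ‖NormedSpace.exp (Complex.I • a)‖ ≤ 1 := by
  rcases subsingleton_or_nontrivial (ObsAlg N φ X) with h | h
  · rw [Subsingleton.elim (NormedSpace.exp (Complex.I • a)) 0, norm_zero]; exact zero_le_one
  · exact (CStarRing.norm_of_mem_unitary (selfAdjoint.expUnitary ⟨a, ha⟩).2).le

end Exp

variable {d N : ℕ} {φ : Flux d} {Ω₀ : Type*} [TopologicalSpace Ω₀] [CompactSpace Ω₀]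

/-- By telescoping and the geometric bounds on powers, the locality constant of `a^n` is at most a
multiple of `n (1 + R)^{2n}`; division by `n!` makes these constants summable. -/
theorem IsTame.exp {a : ObsAlg N φ (Config d Ω₀)} (ha : IsTame a) :
    IsTame (NormedSpace.exp a) := by
  refine ⟨ha.isSmooth.exp, fun K => ?_⟩
  obtain ⟨C, hC0, hC⟩ := ha.exists_locBound K
  obtain ⟨F, R, hF, hR, hFR⟩ := diffNorm_pow_le ha.isSmooth (K + 2 * d)
  have hW := weightSum_nonneg d
  have hB : ∀ n, ∀ i < n, ∀ x, (1 + ‖x‖) ^ (K + 2 * d) * ‖coeff x (a ^ i)‖ ≤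
      2 ^ (K + 2 * d) * (F + F) * (1 + R) ^ n := by
    intro n i hi x
    refine (((ha.isSmooth.pow i).weight_mul_norm_coeff_le x _)).trans ?_
    -- Passing to `1 + R ≥ 1` gives one bound for all exponents `i < n`.
    have h1 : R ^ i ≤ (1 + R) ^ n :=
      (pow_le_pow_left₀ hR (by linarith) i).trans (pow_le_pow_right₀ (by linarith) hi.le)
    have h2 := hFR i 0 (Nat.zero_le _)
    rw [diffNorm_zero_left] at h2
    have h3 := hFR i _ le_rfl
    rw [mul_assoc]
    gcongr
    calc ‖a ^ i‖ + diffNorm (K + 2 * d) (a ^ i) ≤ F * R ^ i + F * R ^ i := add_le_add h2 h3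
      _ = (F + F) * R ^ i := by ring
      _ ≤ _ := by gcongr
  set E := 2 ^ (K + 2 * d) * (F + F) with hE
  have hE0 : 0 ≤ E := by positivity
  have hs := (NormedSpace.exp_series_hasSum_exp' (𝕂 := ℂ) a).mapL pairDiff
  have hb : ∀ n : ℕ, LocBound K
      (E ^ 2 * C * weightSum d ^ 2 * ((2 * (1 + R) ^ 2) ^ n / (n.factorial : ℝ)))
      (pairDiff ((n.factorial : ℂ)⁻¹ • a ^ n)) := by
    intro n
    rw [_root_.map_smul]
    refine ((locBound_pairDiff_pow hC (hB n)).smul _).mono ?_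
    rw [norm_inv, Complex.norm_natCast]
    -- The number `n` of telescoping terms is absorbed into the geometric ratio.
    have h1 : (n : ℝ) ≤ 2 ^ n := by exact_mod_cast Nat.lt_two_pow_self.le
    calc _ = E ^ 2 * C * weightSum d ^ 2 * (n * ((1 + R) ^ 2) ^ n / (n.factorial : ℝ)) := by
          rw [← pow_mul, mul_comm 2 n, pow_mul]
          ring
      _ ≤ E ^ 2 * C * weightSum d ^ 2 * (2 ^ n * ((1 + R) ^ 2) ^ n / (n.factorial : ℝ)) := by
          gcongr
      _ = _ := by rw [mul_pow 2 ((1 + R) ^ 2) n]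
  refine ⟨_, ?_, LocBound.hasSum hs ((Real.summable_pow_div_factorial _).mul_left _) hb⟩
  exact tsum_nonneg fun n => by positivity

/-- For a contraction the powers on both sides of `pairDiff u` have polynomially growing weighted
norms. The exponent counts one power for the number of telescoping terms and `m` for each side. -/
theorem IsTame.exists_locBound_pow {u : ObsAlg N φ (Config d Ω₀)} (hu : IsTame u)
    (h1 : ‖u‖ ≤ 1) (K : ℕ) :
    ∃ (C : ℝ) (p : ℕ), 0 ≤ C ∧ ∀ n : ℕ, LocBound K (C * (1 + n) ^ p) (pairDiff (u ^ n)) := by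
  obtain ⟨C, hC0, hC⟩ := hu.exists_locBound K
  set m := K + 2 * d
  obtain ⟨A, hA0, hA⟩ := diffNorm_pow_le_of_norm_le_one hu.isSmooth h1 0
  obtain ⟨B, hB0, hB⟩ := diffNorm_pow_le_of_norm_le_one hu.isSmooth h1 m
  have hW := weightSum_nonneg d
  refine ⟨(2 ^ m * (A + B)) ^ 2 * C * weightSum d ^ 2, 1 + m + m, by positivity, fun n => ?_⟩
  have hn : (1 : ℝ) ≤ 1 + n := by linarith [Nat.cast_nonneg (α := ℝ) n]
  have hb : ∀ i < n, ∀ x, (1 + ‖x‖) ^ m * ‖coeff x (u ^ i)‖ ≤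
      2 ^ m * (A + B) * (1 + n) ^ m := by
    intro i hi x
    refine (((hu.isSmooth.pow i).weight_mul_norm_coeff_le x _)).trans ?_
    have h2 := hA i
    rw [diffNorm_zero_left, pow_zero] at h2
    have h3 : B * (1 + (i : ℝ)) ^ m ≤ B * (1 + n) ^ m := by gcongr
    have h4 : A * 1 ≤ A * (1 + (n : ℝ)) ^ m := by gcongr; exact one_le_pow₀ hn
    rw [mul_assoc]
    gcongr
    rw [add_mul]
    exact add_le_add (h2.trans h4) ((hB i).trans h3)
  refine (locBound_pairDiff_pow hC hb).mono ?_
  calc _ = (2 ^ m * (A + B)) ^ 2 * C * weightSum d ^ 2 * (n * (1 + n) ^ m * (1 + n) ^ m) := by ring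
    _ ≤ (2 ^ m * (A + B)) ^ 2 * C * weightSum d ^ 2 * ((1 + n) * (1 + n) ^ m * (1 + n) ^ m) := by
        gcongr; linarith
    _ = _ := by ring

theorem exp_intCast_smul (b : ObsAlg N φ (Config d Ω₀)) (k : ℤ) :
    NormedSpace.exp ((k : ℂ) • b) = NormedSpace.exp b ^ k.natAbs ∨
      NormedSpace.exp ((k : ℂ) • b) = NormedSpace.exp (-b) ^ k.natAbs := by
  rcases Int.natAbs_eq k with h | h
  · left
    rw [← exp_natCast_smul]
    conv_lhs => rw [h]
    rw [Int.cast_natCast]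
  · right
    rw [← exp_natCast_smul]
    conv_lhs => rw [h]
    rw [Int.cast_neg, Int.cast_natCast, neg_smul, smul_neg]

theorem exists_diffNorm_exp_le {b : ObsAlg N φ (Config d Ω₀)} (hb : b.IsSmooth)
    (h1 : ‖NormedSpace.exp b‖ ≤ 1) (h2 : ‖NormedSpace.exp (-b)‖ ≤ 1) (m : ℕ) :
    ∃ C : ℝ, ∀ k : ℤ, diffNorm m (NormedSpace.exp ((k : ℂ) • b)) ≤ C * (1 + |(k : ℝ)|) ^ m := by
  have hb' : (-b).IsSmooth := by simpa using hb.smul (-1)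
  obtain ⟨A, hA0, hA⟩ := diffNorm_pow_le_of_norm_le_one hb.exp h1 m
  obtain ⟨B, hB0, hB⟩ := diffNorm_pow_le_of_norm_le_one hb'.exp h2 m
  refine ⟨A + B, fun k => ?_⟩
  have hk : ((k.natAbs : ℕ) : ℝ) = |(k : ℝ)| := by rw [Nat.cast_natAbs, Int.cast_abs]
  have h0 : 0 ≤ (1 + |(k : ℝ)|) ^ m := by positivity
  rcases exp_intCast_smul b k with h | h
  · rw [h]
    refine (hA _).trans ?_
    rw [hk]
    exact mul_le_mul_of_nonneg_right (by linarith) h0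
  · rw [h]
    refine (hB _).trans ?_
    rw [hk]
    exact mul_le_mul_of_nonneg_right (by linarith) h0

theorem exists_locBound_exp {b : ObsAlg N φ (Config d Ω₀)} (hb : IsTame b)
    (h1 : ‖NormedSpace.exp b‖ ≤ 1) (h2 : ‖NormedSpace.exp (-b)‖ ≤ 1) (K : ℕ) :
    ∃ (C : ℝ) (p : ℕ), 0 ≤ C ∧ ∀ k : ℤ,
      LocBound K (C * (1 + |(k : ℝ)|) ^ p) (pairDiff (NormedSpace.exp ((k : ℂ) • b))) := by
  have hb' : IsTame (-b) := by simpa using hb.smul (-1)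
  obtain ⟨A, p, hA0, hA⟩ := hb.exp.exists_locBound_pow h1 K
  obtain ⟨B, q, hB0, hB⟩ := hb'.exp.exists_locBound_pow h2 K
  refine ⟨A + B, p + q, by positivity, fun k => ?_⟩
  have hk : ((k.natAbs : ℕ) : ℝ) = |(k : ℝ)| := by rw [Nat.cast_natAbs, Int.cast_abs]
  have h3 : (1 : ℝ) ≤ 1 + |(k : ℝ)| := by linarith [abs_nonneg (k : ℝ)]
  rcases exp_intCast_smul b k with h | h
  · rw [h]
    refine (hA _).mono ?_
    rw [hk]
    exact mul_le_mul (by linarith) (pow_le_pow_right₀ h3 (by omega)) (by positivity)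
      (by positivity)
  · rw [h]
    refine (hB _).mono ?_
    rw [hk]
    exact mul_le_mul (by linarith) (pow_le_pow_right₀ h3 (by omega)) (by positivity)
      (by positivity)

open scoped ContDiff in
/-- A rapidly convergent Fourier series in a tame one-parameter unitary group is tame. -/
theorem isTame_of_hasSum_exp {b g : ObsAlg N φ (Config d Ω₀)} (hb : IsTame b)
    (h1 : ‖NormedSpace.exp b‖ ≤ 1) (h2 : ‖NormedSpace.exp (-b)‖ ≤ 1) {c : ℤ → ℂ}
    (hc : ∀ p : ℕ, Summable fun k : ℤ => ‖c k‖ * (1 + |(k : ℝ)|) ^ p)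
    (hg : HasSum (fun k : ℤ => c k • NormedSpace.exp ((k : ℂ) • b)) g) : IsTame g := by
  constructor
  · choose C hC using exists_diffNorm_exp_le hb.isSmooth h1 h2
    have hsm : ∀ k : ℤ, (NormedSpace.exp ((k : ℂ) • b)).IsSmooth :=
      fun k => (hb.isSmooth.smul _).exp
    have ho : orbit g = fun t => ∑' k : ℤ, (c k • orbit (NormedSpace.exp ((k : ℂ) • b))) t := by
      funext t
      have := hg.mapL (mapL (CovPoly.torusAct fun j => Circle.exp (t j)))
      simp only [_root_.map_smul] at this
      exact this.tsum_eq.symm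
    rw [IsSmooth, ho]
    -- The derivatives of the terms have norms independent of `t`, so the polynomial growth in `k`
    -- against the decay of `c` gives a uniform majorant in every order.
    refine contDiff_tsum (v := fun m k => C m * (‖c k‖ * (1 + |(k : ℝ)|) ^ m))
      (fun k => by rw [← orbit_smul]; exact (hsm k).smul (c k)) (fun m _ => (hc m).mul_left _) fun m k t _ => ?_
    rw [iteratedFDeriv_const_smul_apply ((hsm k).contDiffAt.of_le (by exact_mod_cast le_top)),
      norm_smul, (hsm k).norm_iteratedFDeriv_orbit]
    calc _ ≤ ‖c k‖ * (C m * (1 + |(k : ℝ)|) ^ m) :=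
          mul_le_mul_of_nonneg_left (hC m k) (norm_nonneg _)
      _ = _ := by ring
  · intro K
    obtain ⟨C, p, hC0, hC⟩ := exists_locBound_exp hb h1 h2 K
    have hs := hg.mapL pairDiff
    simp only [_root_.map_smul] at hs
    have hsum : Summable fun k : ℤ => ‖c k‖ * (C * (1 + |(k : ℝ)|) ^ p) := by
      refine ((hc p).mul_left C).congr fun k => by ring
    exact ⟨_, tsum_nonneg fun k => by positivity, LocBound.hasSum hs hsum fun k => (hC k).smul _⟩

end ObsAlg

end NCBT

end

noncomputable section

set_option linter.unusedSectionVars false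

namespace NCBT

open scoped ContDiff SchwartzMap FourierTransform

/-! ### Fourier expansion of smooth functions on an interval -/

/-- The transform is again Schwartz; a seminorm of order `p + 2` leaves two spare powers, enough for
summability over `ℤ`. -/
theorem summable_fourier_mul_pow (f : 𝓢(ℝ, ℂ)) (p : ℕ) :
    Summable fun k : ℤ => ‖(𝓕 f) (k : ℝ)‖ * (1 + |(k : ℝ)|) ^ p := by
  set C := 2 ^ (p + 2) * ((Finset.Iic (p + 2, 0)).sup
    fun m => SchwartzMap.seminorm ℝ m.1 m.2) (𝓕 f) with hC
  refine Summable.of_nonneg_of_le (fun k => by positivity) (fun k => ?_)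
    (summable_one_add_norm_int.mul_left C)
  have h1 := SchwartzMap.one_add_le_sup_seminorm_apply (𝕜 := ℝ) (m := (p + 2, 0)) (k := p + 2)
    (n := 0) le_rfl le_rfl (𝓕 f) (k : ℝ)
  rw [norm_iteratedFDeriv_zero, Real.norm_eq_abs] at h1
  rw [← div_eq_mul_inv, le_div_iff₀ (by positivity), Int.norm_eq_abs]
  calc _ = (1 + |(k : ℝ)|) ^ (p + 2) * ‖(𝓕 f) (k : ℝ)‖ := by ring
    _ ≤ C := h1

/-- The radii `1/4` and `1/2` are chosen so that nonzero integer translates of the cut-off function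
vanish on `[-1/4, 1/4]`. -/
theorem exists_schwartz_eqOn {g : ℝ → ℂ} (hg : ContDiff ℝ ∞ g) :
    ∃ f : 𝓢(ℝ, ℂ), (∀ y, |y| ≤ 1 / 4 → f y = g y) ∧ ∀ y, 1 / 2 ≤ |y| → f y = 0 := by
  obtain ⟨β, hβ1, hβ0, hβ⟩ : ∃ β : ℝ → ℝ, (∀ y, |y| ≤ 1 / 4 → β y = 1) ∧
      (∀ y, 1 / 2 ≤ |y| → β y = 0) ∧ ContDiff ℝ ∞ β := by
    let β : ContDiffBump (0 : ℝ) := ⟨1 / 4, 1 / 2, by norm_num, by norm_num⟩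
    refine ⟨β, fun y hy => β.one_of_mem_closedBall ?_, fun y hy => β.zero_of_le_dist ?_,
      β.contDiff⟩
    · rw [Metric.mem_closedBall, dist_zero_right]; exact hy
    · rw [dist_zero_right]; exact hy
  have hF : ContDiff ℝ ∞ fun y => (β y : ℂ) * g y :=
    (Complex.ofRealCLM.contDiff.comp hβ).mul hg
  have hFs : HasCompactSupport fun y => (β y : ℂ) * g y := by
    refine HasCompactSupport.intro (isCompact_closedBall (0 : ℝ) (1 / 2)) fun y hy => ?_
    rw [Metric.mem_closedBall, not_le, dist_zero_right] at hy
    rw [hβ0 y hy.le, Complex.ofReal_zero, zero_mul]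
  refine ⟨hFs.toSchwartzMap hF, fun y hy => ?_, fun y hy => ?_⟩
  · rw [HasCompactSupport.toSchwartzMap_toFun, hβ1 y hy, Complex.ofReal_one, one_mul]
  · rw [HasCompactSupport.toSchwartzMap_toFun, hβ0 y hy, Complex.ofReal_zero, zero_mul]

/-- Poisson summation: the Fourier series with coefficients `𝓕 f` at the integers sums to `∑ₙ f (y +
n)`, and for `|y| ≤ 1/4` only `n = 0` contributes. -/
theorem exists_fourier_of_schwartz (f : 𝓢(ℝ, ℂ)) (hf : ∀ y, 1 / 2 ≤ |y| → f y = 0) :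
    ∃ c : ℤ → ℂ, (∀ p : ℕ, Summable fun k : ℤ => ‖c k‖ * (1 + |(k : ℝ)|) ^ p) ∧
      ∀ y : ℝ, |y| ≤ 1 / 4 → ∑' k : ℤ, c k * fourier k (y : UnitAddCircle) = f y := by
  refine ⟨_, summable_fourier_mul_pow f, fun y hy => ?_⟩
  refine (SchwartzMap.tsum_eq_tsum_fourier f y).symm.trans ?_
  rw [tsum_eq_single 0, Int.cast_zero, add_zero]
  intro n hn
  refine hf _ ?_
  have h3 : (1 : ℝ) ≤ |(n : ℝ)| := by exact_mod_cast Int.one_le_abs hn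
  have h4 := abs_sub_abs_le_abs_sub (n : ℝ) (-y)
  rw [abs_neg, sub_neg_eq_add, add_comm (n : ℝ)] at h4
  linarith

/-- Rescaling by `4 * R` turns `[-R, R]` into `[-1/4, 1/4]`. The other half of the period `4 * R`
leaves room for the cutoff, so `g` itself need not be periodic. -/
theorem exists_fourier_expansion {g : ℝ → ℂ} (hg : ContDiff ℝ ∞ g) {R : ℝ} (hR : 0 < R) :
    ∃ c : ℤ → ℂ, (∀ p : ℕ, Summable fun k : ℤ => ‖c k‖ * (1 + |(k : ℝ)|) ^ p) ∧
      ∀ x : ℝ, |x| ≤ R → ∑' k : ℤ,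
        c k * Complex.exp (k * (2 * Real.pi / (4 * R) * Complex.I * x)) = g x := by
  obtain ⟨f, hf1, hf0⟩ := exists_schwartz_eqOn
    (hg.comp (contDiff_const.mul contDiff_id : ContDiff ℝ ∞ fun y : ℝ => 4 * R * y))
  obtain ⟨c, hc, hcf⟩ := exists_fourier_of_schwartz f hf0
  refine ⟨c, hc, fun x hx => ?_⟩
  have hy : |x / (4 * R)| ≤ 1 / 4 := by
    rw [abs_div, abs_of_pos (by positivity : 0 < 4 * R),
      div_le_div_iff₀ (by positivity) (by norm_num)]
    linarith
  have h1 := hcf _ hy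
  rw [hf1 _ hy, Function.comp_apply, mul_div_cancel₀ _ (by positivity : (4 * R) ≠ 0)] at h1
  rw [← h1]
  refine tsum_congr fun k => ?_
  rw [fourier_coe_apply]
  congr 2
  push_cast
  field_simp

/-! ### Smooth functional calculus -/

/-- The spectrum is real, so the exponentials have modulus one there and the series converges
uniformly by the Weierstrass test; the functional calculus is continuous under uniform convergence
on the spectrum. -/
theorem hasSum_cfc_exp {A : Type*} [CStarAlgebra A] {h : A} (hsa : IsSelfAdjoint h)
    {c : ℤ → ℂ} (hc : Summable fun k => ‖c k‖) (t : ℝ) {G : ℂ → ℂ}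
    (hG : ∀ z ∈ spectrum ℂ h,
      ∑' k : ℤ, c k * Complex.exp (k * (t * Complex.I * z)) = G z) :
    HasSum (fun k : ℤ => c k • NormedSpace.exp ((k : ℂ) • ((t * Complex.I) • h)))
      (cfc G h) := by
  have hn : IsStarNormal h := hsa.isStarNormal
  have hre : ∀ z ∈ spectrum ℂ h, (z.re : ℂ) = z := fun z hz => (hsa.mem_spectrum_eq_re hz).symm
  have h1 : TendstoUniformlyOn
      (fun (s : Finset ℤ) (z : ℂ) => ∑ k ∈ s, c k * Complex.exp (k * (t * Complex.I) * z))
      G Filter.atTop (spectrum ℂ h) := by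
    refine (tendstoUniformlyOn_tsum hc fun k z hz => ?_).congr_right fun z hz => ?_
    · rw [norm_mul, ← hre z hz]
      have : (k : ℂ) * (t * Complex.I) * (z.re : ℂ) = ((k * t * z.re : ℝ) : ℂ) * Complex.I := by
        push_cast; ring
      rw [this, Complex.norm_exp_ofReal_mul_I, mul_one]
    · rw [← hG z hz]
      exact tsum_congr fun k => by rw [mul_assoc]
  have h2 := tendsto_cfc_fun (a := h) h1 (Filter.Eventually.of_forall fun s => by fun_prop)
  have h3 : ∀ s : Finset ℤ,
      cfc (fun z : ℂ => ∑ k ∈ s, c k * Complex.exp (k * (t * Complex.I) * z)) h =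
        ∑ k ∈ s, c k • NormedSpace.exp ((k : ℂ) • ((t * Complex.I) • h)) := by
    intro s
    have : (fun z : ℂ => ∑ k ∈ s, c k * Complex.exp (k * (t * Complex.I) * z)) =
        ∑ k ∈ s, fun z : ℂ => c k * Complex.exp (k * (t * Complex.I) * z) := by
      funext z
      rw [Finset.sum_apply]
    rw [this, cfc_sum (fun (k : ℤ) (z : ℂ) => c k * Complex.exp (k * (t * Complex.I) * z)) h s
      (fun k _ => by fun_prop)]
    refine Finset.sum_congr rfl fun k _ => ?_
    rw [cfc_const_mul (c k) (fun z => Complex.exp (k * (t * Complex.I) * z)) h (by fun_prop),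
      smul_smul]
    congr 1
    have hn' : IsStarNormal (((k : ℂ) * (t * Complex.I)) • h) := by infer_instance
    rw [← CFC.exp_eq_normedSpace_exp (𝕜 := ℂ) (p := IsStarNormal), ← Complex.exp_eq_exp_ℂ,
      ← cfc_comp_const_mul ((k : ℂ) * (t * Complex.I)) Complex.exp h (by fun_prop)]
  simp only [h3] at h2
  exact h2

namespace ObsAlg

variable {d N : ℕ} {φ : Flux d} {Ω₀ : Type*} [TopologicalSpace Ω₀] [CompactSpace Ω₀]

theorem IsTame.funCalc {h : ObsAlg N φ (Config d Ω₀)} (hh : IsTame h) (hsa : IsSelfAdjoint h)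
    {G : ℝ → ℂ} (hG : SmoothOver (spectrum ℝ h) G) : IsTame (funCalc G h) := by
  obtain ⟨g, hg, hgG⟩ := hG
  -- The factor `‖1‖` gives a bound on the spectrum that is also valid in the zero algebra; adding
  -- `1` makes `R` positive.
  set R : ℝ := ‖h‖ * ‖(1 : ObsAlg N φ (Config d Ω₀))‖ + 1 with hR
  have hR0 : 0 < R := by positivity
  obtain ⟨c, hc, hcg⟩ := exists_fourier_expansion hg hR0
  set t : ℝ := 2 * Real.pi / (4 * R) with ht
  have hb : IsTame (((t : ℂ) * Complex.I) • h) := hh.smul _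
  have hsa' : ∀ s : ℝ, IsSelfAdjoint ((s : ℂ) • h) := fun s =>
    IsSelfAdjoint.smul (by simp [isSelfAdjoint_iff]) hsa
  have h1 : ‖NormedSpace.exp (((t : ℂ) * Complex.I) • h)‖ ≤ 1 := by
    rw [mul_comm, mul_smul]
    exact norm_exp_I_smul_le (hsa' t)
  have h2 : ‖NormedSpace.exp (-(((t : ℂ) * Complex.I) • h))‖ ≤ 1 := by
    have : -(((t : ℂ) * Complex.I) • h) = Complex.I • (((-t : ℝ) : ℂ) • h) := by
      rw [smul_smul, ← neg_smul]
      congr 1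
      push_cast
      ring
    rw [this]
    exact norm_exp_I_smul_le (hsa' (-t))
  refine isTame_of_hasSum_exp hb h1 h2 hc (hasSum_cfc_exp hsa (by simpa using hc 0) t ?_)
  intro z hz
  have hre : (z.re : ℂ) = z := (hsa.mem_spectrum_eq_re hz).symm
  have hz' : z.re ∈ spectrum ℝ h := by
    rw [← hre] at hz
    exact (spectrum.algebraMap_mem_iff ℂ (R := ℝ)).1 hz
  rw [← hgG hz', ← hcg z.re]
  · refine tsum_congr fun k => ?_
    rw [hre, ht]
    push_cast
    rfl
  · have := spectrum.subset_closedBall_norm_mul h hz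
    rw [Metric.mem_closedBall, dist_zero_right] at this
    linarith [Complex.abs_re_le_norm z]

end ObsAlg

end NCBT

end

noncomputable section

set_option linter.unusedSectionVars false

namespace NCBT

/-! ### Localization in cubes -/

theorem mem_cube_iff {d L : ℕ} {x : Fin d → ℤ} :
    x ∈ cube d L ↔ ∀ j, -(L : ℤ) ≤ x j ∧ x j ≤ L := by
  simp [cube, Fintype.mem_piFinset]

theorem card_cube (d L : ℕ) : (cube d L).card = (2 * L + 1) ^ d := by
  rw [cube, Fintype.card_piFinset, Finset.prod_const, Finset.card_univ, Fintype.card_fin,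
    Int.card_Icc]
  congr 1
  omega

theorem norm_le_of_mem_cube {d L : ℕ} {x : Fin d → ℤ} (hx : x ∈ cube d L) : ‖x‖ ≤ L := by
  refine (pi_norm_le_iff_of_nonneg (Nat.cast_nonneg L)).2 fun j => ?_
  rw [Int.norm_eq_abs]
  exact_mod_cast abs_le.2 (mem_cube_iff.1 hx j)

/-- Norms of lattice points are integers, so `‖x‖ < L + 1` describes `V_L`; agreement on `V_L` is
`AgreeBelow (L + 1)`. -/
theorem mem_cube_of_norm_lt {d L : ℕ} {x : Fin d → ℤ} (hx : ‖x‖ < (L + 1 : ℕ)) :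
    x ∈ cube d L := by
  refine mem_cube_iff.2 fun j => ?_
  have h := (norm_le_pi_norm x j).trans_lt hx
  rw [Int.norm_eq_abs] at h
  have h' : |x j| < ((L + 1 : ℕ) : ℤ) := by exact_mod_cast h
  have := abs_lt.1 h'
  push_cast at this
  omega

/-- Converts volume into the length scale of `LocBound` at `M = L + 1`. The exponent `d + 1` leaves
room for the summand `1` and also covers `d = 0`. -/
theorem one_add_card_cube_le (d L : ℕ) :
    1 + ((cube d L).card : ℝ) ≤ (2 * (1 + ((L + 1 : ℕ) : ℝ))) ^ (d + 1) := by
  rw [card_cube]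
  push_cast
  have h1 : (1 : ℝ) ≤ (2 * (1 + ((L : ℝ) + 1))) ^ d := one_le_pow₀ (by
    linarith [Nat.cast_nonneg (α := ℝ) L])
  have h2 : (2 * (L : ℝ) + 1) ^ d ≤ (2 * (1 + ((L : ℝ) + 1))) ^ d :=
    pow_le_pow_left₀ (by positivity) (by linarith) d
  rw [pow_succ]
  nlinarith [Nat.cast_nonneg (α := ℝ) L]

namespace ObsAlg

variable {d N : ℕ} {φ : Flux d} {Ω₀ : Type*} [TopologicalSpace Ω₀] [CompactSpace Ω₀]

theorem IsSmooth.isTame {h : ObsAlg N φ (Config d Ω₀)} (hs : h.IsSmooth) (hl : h.IsLocalized) :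
    IsTame h := by
  refine ⟨hs, fun K => ?_⟩
  obtain ⟨A, hA0, hA⟩ := hl K
  refine ⟨2 * ‖h‖ + A, by positivity, fun M x η hη => ?_⟩
  rw [coeff_pairDiff]
  -- For `M = 0` only the uniform bound `2‖h‖` is available; agreement below `M + 1` is agreement on
  -- `V_M`.
  rcases M with _ | M
  · rw [Nat.cast_zero, add_zero, one_pow, one_mul]
    have h1 : ∀ ω, ‖coeff x h ω‖ ≤ ‖h‖ := fun ω =>
      ((coeff x h).norm_coe_le_norm ω).trans (norm_coeff_le x h)
    linarith [norm_sub_le (coeff x h η.1) (coeff x h η.2), h1 η.1, h1 η.2]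
  · have hag : ∀ y ∈ cube d M, η.1 y = η.2 y := fun y hy => hη y
      ((norm_le_of_mem_cube hy).trans_lt (by exact_mod_cast M.lt_succ_self))
    -- In dimension zero the volume does not grow with `M`, but `V_M` is the whole lattice and the
    -- configurations coincide.
    rcases Nat.eq_zero_or_pos d with hd | hd
    · subst hd
      have : η.1 = η.2 := funext fun y => hag y (mem_cube_iff.2 fun j => j.elim0)
      rw [this, sub_self, norm_zero, mul_zero]
      positivity
    · have h1 := hA x M η.1 η.2 hag
      rw [le_div_iff₀ (by positivity)] at h1
      have h2 : 1 + ((M + 1 : ℕ) : ℝ) ≤ 1 + ((cube d M).card : ℝ) := by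
        rw [card_cube]
        have : M + 1 ≤ (2 * M + 1) ^ d :=
          le_trans (by omega) (Nat.le_self_pow hd.ne' (2 * M + 1))
        have h3 : ((M + 1 : ℕ) : ℝ) ≤ (((2 * M + 1) ^ d : ℕ) : ℝ) := by exact_mod_cast this
        linarith
      calc _ ≤ (1 + ((cube d M).card : ℝ)) ^ K * ‖coeff x h η.1 - coeff x h η.2‖ := by gcongr
        _ ≤ A := by rw [mul_comm]; exact h1
        _ ≤ _ := by linarith [norm_nonneg h]

/-! ### Restriction to the periodic configurations -/

section Periodic

variable [T2Space Ω₀] (L : ℕ)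

theorem incl_vadd (y : Fin d → ℤ) (η : PeriodicConfig d Ω₀ L) :
    PeriodicConfig.incl (y +ᵥ η) = y +ᵥ PeriodicConfig.incl η := rfl

theorem toPeriodic_eq : (toPeriodic L : ObsAlg N φ (Config d Ω₀) →⋆ₐ[ℂ] _) =
    map (CovPoly.pull PeriodicConfig.incl (incl_vadd L)) := rfl

theorem continuous_toPeriodic :
    Continuous (toPeriodic L : ObsAlg N φ (Config d Ω₀) →⋆ₐ[ℂ] _) := continuous_map _

theorem IsSmooth.toPeriodic {a : ObsAlg N φ (Config d Ω₀)} (ha : a.IsSmooth) :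
    (toPeriodic L a).IsSmooth := by
  rw [toPeriodic_eq]; exact ha.map_pull _ _

theorem IsSmooth.toPeriodic_multiDeriv {a : ObsAlg N φ (Config d Ω₀)} (ha : a.IsSmooth)
    (α : Fin d → ℕ) :
    ObsAlg.toPeriodic L (multiDeriv α a) = multiDeriv α (ObsAlg.toPeriodic L a) := by
  unfold multiDeriv
  -- Smoothness is carried along in the induction because intertwining each `∂ⱼ` requires it.
  suffices h : ∀ l : List (Fin d),
      (l.foldr (fun j b => (ObsAlg.pderiv j)^[α j] b) a).IsSmooth ∧
      ObsAlg.toPeriodic L (l.foldr (fun j b => (ObsAlg.pderiv j)^[α j] b) a) =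
        l.foldr (fun j b => (ObsAlg.pderiv j)^[α j] b) (ObsAlg.toPeriodic L a) from (h _).2
  intro l
  induction l with
  | nil => exact ⟨ha, rfl⟩
  | cons j l ih =>
    rw [List.foldr_cons, List.foldr_cons]
    generalize α j = k
    induction k with
    | zero => exact ih
    | succ k ihk =>
      rw [Function.iterate_succ_apply', Function.iterate_succ_apply', ← ihk.2]
      refine ⟨ihk.1.pderiv j, ?_⟩
      rw [toPeriodic_eq]
      exact ihk.1.map_pull_pderiv _ _ j

theorem toPeriodic_funCalc {h : ObsAlg N φ (Config d Ω₀)} (hsa : IsSelfAdjoint h)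
    {G : ℝ → ℂ} (hG : SmoothOver (spectrum ℝ h) G) :
    toPeriodic L (funCalc G h) = funCalc G (toPeriodic L h) := by
  obtain ⟨g, hg, hgG⟩ := hG
  have hn : IsStarNormal h := hsa.isStarNormal
  have hn' : IsStarNormal (toPeriodic L h) := (hsa.map (toPeriodic L)).isStarNormal
  -- Off the spectrum `G` is arbitrary; continuity on it comes from the smooth representative.
  have hG : ContinuousOn (fun z : ℂ => G z.re) (spectrum ℂ h) := by
    refine ContinuousOn.congr (f := fun z : ℂ => g z.re)
      (hg.continuous.comp Complex.continuous_re).continuousOn fun z hz => ?_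
    have hre : (z.re : ℂ) = z := (hsa.mem_spectrum_eq_re hz).symm
    refine (hgG ?_).symm
    rw [← hre] at hz
    exact (spectrum.algebraMap_mem_iff ℂ (R := ℝ)).1 hz
  exact StarAlgHomClass.map_cfc (S := ℂ) (toPeriodic L) (fun z : ℂ => G z.re) h hG
    (continuous_toPeriodic L) hn hn'

theorem toPeriodic_list_prod (l : List (ObsAlg N φ (Config d Ω₀))) :
    toPeriodic L l.prod = (l.map (toPeriodic L)).prod := map_list_prod _ l

theorem coeff_toPeriodic (x : Fin d → ℤ) (a : ObsAlg N φ (Config d Ω₀))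
    (η : PeriodicConfig d Ω₀ L) : coeff x (toPeriodic L a) η = coeff x a η.1 := by
  rw [toPeriodic_eq, coeff_map_pull]; rfl

end Periodic

/-! ### Traces -/

/-- The normalized trace as a continuous linear functional. -/
def trL (N : ℕ) : Mat N →L[ℂ] ℂ :=
  haveI : FiniteDimensional ℂ (Mat N) :=
    inferInstanceAs (FiniteDimensional ℂ (Matrix (Fin N) (Fin N) ℂ))
  LinearMap.toContinuousLinearMap
    ((N : ℂ)⁻¹ • (Matrix.traceLinearMap (Fin N) ℂ ℂ : Matrix (Fin N) (Fin N) ℂ →ₗ[ℂ] ℂ) :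
      Mat N →ₗ[ℂ] ℂ)

theorem trL_apply (A : Mat N) : trL N A = A.tr := rfl

variable [TopologicalSpace.MetrizableSpace Ω₀] [MeasurableSpace Ω₀] [BorelSpace Ω₀]

theorem measurable_periodize (L : ℕ) :
    Measurable (Config.periodize L : Config d Ω₀ → PeriodicConfig d Ω₀ L) :=
  Measurable.subtype_mk (measurable_pi_lambda _ fun _ => measurable_pi_apply _)

/-- A compact metrizable space is second countable and the lattice is countable, so the product
`σ`-algebra is the Borel one and continuous integrands are measurable. -/
theorem borelSpace_config : SecondCountableTopology (Config d Ω₀) ∧ BorelSpace (Config d Ω₀) := by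
  let := TopologicalSpace.metrizableSpaceMetric Ω₀
  have h : SecondCountableTopology Ω₀ := inferInstance
  exact ⟨inferInstanceAs (SecondCountableTopology ((Fin d → ℤ) → Ω₀)),
    inferInstanceAs (BorelSpace ((Fin d → ℤ) → Ω₀))⟩

theorem trace_periodicMeasure (L : ℕ) (μ : Measure (Config d Ω₀)) (a : ObsAlg N φ (Config d Ω₀)) :
    trace (Config.periodicMeasure L μ) (toPeriodic L a) =
      ∫ ω, Mat.tr (coeff 0 a (Config.periodize L ω).1) ∂μ := by
  obtain ⟨h1, h2⟩ := borelSpace_config (d := d) (Ω₀ := Ω₀)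
  have h3 : BorelSpace (PeriodicConfig d Ω₀ L) :=
    inferInstanceAs (BorelSpace (Subtype _))
  rw [trace, Config.periodicMeasure, integral_map (measurable_periodize L).aemeasurable]
  · simp only [coeff_toPeriodic]
  · refine Continuous.aestronglyMeasurable ?_
    exact (trL N).continuous.comp (coeff 0 (toPeriodic L a)).continuous

/-- After the change of variables both traces are integrals over `μ`, and the difference of the
integrands is the trace of the zeroth coefficient of `pairDiff a` at the pair of `ω` and its
periodization. -/
theorem IsTame.norm_trace_sub_le {a : ObsAlg N φ (Config d Ω₀)} (ha : IsTame a)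
    (μ : Measure (Config d Ω₀)) [IsProbabilityMeasure μ] (K : ℕ) :
    ∃ A : ℝ, ∀ L : ℕ, ‖trace μ a - trace (Config.periodicMeasure L μ) (toPeriodic L a)‖ ≤
      A / (1 + ((cube d L).card : ℝ)) ^ K := by
  obtain ⟨h1, h2⟩ := borelSpace_config (d := d) (Ω₀ := Ω₀)
  -- Each power of `1 + |V_L|` costs `d + 1` powers of the length, by `one_add_card_cube_le`.
  obtain ⟨C, hC0, hC⟩ := ha.exists_locBound ((d + 1) * K)
  refine ⟨‖trL N‖ * (2 ^ ((d + 1) * K) * C), fun L => ?_⟩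
  have hint : ∀ f : Config d Ω₀ → Config d Ω₀, Measurable f →
      Integrable (fun ω => Mat.tr (coeff 0 a (f ω))) μ := by
    intro f hf
    have hcont : Continuous fun ω => Mat.tr (coeff 0 a ω) :=
      (trL N).continuous.comp (coeff 0 a).continuous
    refine Integrable.of_bound (C := ‖trL N‖ * ‖coeff 0 a‖)
      (hcont.measurable.comp hf).aestronglyMeasurable (Filter.Eventually.of_forall fun ω => ?_)
    exact ((trL N).le_opNorm _).trans (by gcongr; exact (coeff 0 a).norm_coe_le_norm _)
  have e1 : Integrable (fun ω => Mat.tr (coeff 0 a ω)) μ := hint id measurable_id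
  have e2 : Integrable (fun ω => Mat.tr (coeff 0 a (Config.periodize L ω).1)) μ :=
    hint _ (measurable_subtype_coe.comp (measurable_periodize L))
  rw [trace_periodicMeasure, trace, ← integral_sub e1 e2]
  refine (norm_integral_le_of_norm_le_const (C := ‖trL N‖ * (2 ^ ((d + 1) * K) * C) /
    (1 + ((cube d L).card : ℝ)) ^ K) (Filter.Eventually.of_forall fun ω => ?_)).trans ?_
  · have hag : AgreeBelow (L + 1) (ω, (Config.periodize L ω).1) := fun z hz =>
      (Config.periodize_apply L ω z (mem_cube_iff.1 (mem_cube_of_norm_lt hz))).symm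
    have h4 := hC (L + 1) 0 _ hag
    rw [coeff_pairDiff] at h4
    rw [← trL_apply, ← trL_apply, ← _root_.map_sub, mul_div_assoc]
    refine ((trL N).le_opNorm _).trans ?_
    gcongr
    rw [le_div_iff₀ (by positivity)]
    calc _ ≤ ‖coeff 0 a ω - coeff 0 a (Config.periodize L ω).1‖ *
          ((2 * (1 + ((L + 1 : ℕ) : ℝ))) ^ (d + 1)) ^ K := by
          gcongr; exact one_add_card_cube_le d L
      _ = 2 ^ ((d + 1) * K) * ((1 + ((L + 1 : ℕ) : ℝ)) ^ ((d + 1) * K) *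
          ‖coeff 0 a ω - coeff 0 a (Config.periodize L ω).1‖) := by
          rw [← pow_mul, mul_pow]; ring
      _ ≤ _ := by gcongr
  · simp

end ObsAlg

end NCBT

end

/-! ### The correlation estimate -/

theorem mainTheorem3 {d N : ℕ} (φ : NCBT.Flux d) {Ω₀ : Type*} [TopologicalSpace Ω₀]
    [CompactSpace Ω₀] [TopologicalSpace.MetrizableSpace Ω₀] [MeasurableSpace Ω₀] [BorelSpace Ω₀]
    (μ : MeasureTheory.Measure (NCBT.Config d Ω₀)) (hμ : NCBT.IsDisorderMeasure μ)
    (h : NCBT.ObsAlg N φ (NCBT.Config d Ω₀)) (hsa : IsSelfAdjoint h)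
    (ha1 : h.IsSmooth) (ha2 : h.IsLocalized)
    {n : ℕ} (G : Fin n → ℝ → ℂ) (hG : ∀ i, NCBT.SmoothOver (spectrum ℝ h) (G i))
    (α : Fin n → Fin d → ℕ) :
    (∀ i, (NCBT.ObsAlg.funCalc (G i) h).IsSmooth) ∧
    (∀ (L : ℕ) (i : Fin n), (NCBT.ObsAlg.funCalc (G i) (NCBT.ObsAlg.toPeriodic L h)).IsSmooth) ∧
    ∀ K : ℕ, ∃ A : ℝ, ∀ L : ℕ,
      ‖NCBT.ObsAlg.correlation μ α G h -
          NCBT.ObsAlg.correlation (NCBT.Config.periodicMeasure L μ) α G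
            (NCBT.ObsAlg.toPeriodic L h)‖ ≤
        A / (1 + ((NCBT.cube d L).card : ℝ)) ^ K := by
  have hF : ∀ i, NCBT.ObsAlg.IsTame (NCBT.ObsAlg.funCalc (G i) h) :=
    fun i => (ha1.isTame ha2).funCalc hsa (hG i)
  refine ⟨fun i => (hF i).isSmooth, fun L i => ?_, fun K => ?_⟩
  · rw [← NCBT.ObsAlg.toPeriodic_funCalc L hsa (hG i)]
    exact (hF i).isSmooth.toPeriodic L
  · have := hμ.isProbabilityMeasure
    have hprod : NCBT.ObsAlg.IsTame
        (List.ofFn fun i => NCBT.ObsAlg.multiDeriv (α i) (NCBT.ObsAlg.funCalc (G i) h)).prod := by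
      refine NCBT.ObsAlg.isTame_list_prod fun a ha => ?_
      obtain ⟨i, rfl⟩ := (List.mem_ofFn' _ _).1 ha
      exact (hF i).multiDeriv (α i)
    obtain ⟨A, hA⟩ := hprod.norm_trace_sub_le μ K
    refine ⟨A, fun L => le_trans (le_of_eq ?_) (hA L)⟩
    -- The periodic correlation is rewritten as the trace of the image under `𝔭̃_L` of the product
    -- on `Ω`, factor by factor.
    rw [NCBT.ObsAlg.correlation, NCBT.ObsAlg.correlation, NCBT.ObsAlg.toPeriodic_list_prod,
      List.map_ofFn]
    congr 5
    funext i
    rw [Function.comp_apply, (hF i).isSmooth.toPeriodic_multiDeriv L,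
      NCBT.ObsAlg.toPeriodic_funCalc L hsa (hG i)]
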